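/- **Theorem 3.1.** Let $M$ be a smooth Riemannian manifold of dimension $n\ge 1$ with metric $\mathbf g$, metric connection $\Gamma^k_{ij}$ and scalar product $(\cdot\,|\,\cdot)$. Let $\mathbf F$ be an extended vector field, i.e. a rule assigning to each $(p,\mathbf v)\in TM$ a vector $\mathbf F(p,\mathbf v)\in T_pM$, which is smooth at all $(p,\mathbf v)$ with $\mathbf v\ne 0$. Consider the Newtonian dynamical system with force field $\mathbf F$, given in local coordinates by $$\ddot x^k+\sum_{i,j=1}^n\Gamma^k_{ij}\,\dot x^i\dot x^j=F^k(x^1,\dots,x^n,\dot x^1,\dots,\dot x^n),\qquad k=1,\dots,n.$$ The system is said to *admit normal blow-up of points* if for every $p_0\in M$ and every $\nu_0>0$ the following holds, where $\sigma$ is the unit sphere of $T_{p_0}M$ and $\mathbf n(q)\in T_{p_0}M$ is the radius vector of $q\in\sigma$. For some $\varepsilon>0$ there is a smooth map $(q,t)\mapsto f_t(q)$ from $\sigma\times(-\varepsilon,\varepsilon)$ to $M$ such that - for each $q\in\sigma$ the curve $t\mapsto f_t(q)$ is a trajectory of the system with initial data $f_0(q)=p_0$, $\dot f_0(q)=\nu_0\,\mathbf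 n(q)$; - for $0<t<\varepsilon$ the map $f_t$ is a smooth embedding, i.e. a diffeomorphism of $\sigma$ onto a smooth hypersurface $S_t=f_t(\sigma)$; - for $0<t<\varepsilon$ the hypersurface $S_t$ is orthogonal to the trajectories, i.e. at each point $f_t(q)$ the velocity $\dot f_t(q)$ is orthogonal to all vectors tangent to $S_t$. In local coordinates put $F_i=\sum_j g_{ij}F^j$, $v=|\mathbf v|$, $N^i=v^i/v$, $N_i=\sum_j g_{ij}N^j$, $P^i_k=\delta^i_k-N^iN_k$. Let $\tilde\nabla_i=\partial/\partial v^i$ denote the velocity gradient, and let $$\nabla_iF_j=\frac{\partial F_j}{\partial x^i}-\sum_{a,b=1}^n\Gamma^a_{ib}\,v^b\,\frac{\partial F_j}{\partial v^a}-\sum_{a=1}^n\Gamma^a_{ij}\,F_a$$ denote the spatial gradient. If the system admits normal blow-up of points, then at every point $(p,\mathbf v)\in TM$ with $\mathbf v\neq0$, in any local coordinates of $M$ around $p$ and for all $k=1,\dots,n$, $$\sum_{i=1}^n\Bigl(v^{-1}F_i+\sum_{j=1}^n\tilde\nabla_i\bigl(N^jF_j\bigr)\Bigr)P^i_k=0,$$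 $$\sum_{i,j=1}^n\bigl(\nabla_iF_j+\nabla_jF_i-2\,v^{-2}F_iF_j\bigr)N^jP^i_k+\sum_{i,j=1}^n\Bigl(\frac{F^j\,\tilde\nabla_jF_i}{v}-\sum_{r=1}^n\frac{N^rN^j\,\tilde\nabla_jF_r}{v}\,F_i\Bigr)P^i_k=0.$$ -/

import Mathlib

open Bundle Set Metric Manifold
open scoped ContDiff Manifold

noncomputable section

namespace NormalBlowUp

/-- Coordinate space `ℝⁿ`. -/
abbrev Coord (n : ℕ) : Type := EuclideanSpace ℝ (Fin n)

/-- The `i`-th standard basis vector of `ℝⁿ`. -/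
abbrev basisVec {n : ℕ} (i : Fin n) : Coord n := EuclideanSpace.single i 1

/-- The partial derivative `∂φ/∂xⁱ` of a real function of `n` variables. -/
def partialDeriv {n : ℕ} (i : Fin n) (φ : Coord n → ℝ) (x : Coord n) : ℝ :=
  fderiv ℝ φ x (basisVec i)

section Charts

variable {n : ℕ} {M : Type*} [TopologicalSpace M] [ChartedSpace (Coord n) M]

/-- The tangent vector `∑ vⁱ ∂/∂xⁱ` at the point with coordinates `x` in the chart `e`. -/
def vecOfCoord (e : OpenPartialHomeomorph M (Coord n)) (x v : Coord n) :
    TangentSpace (𝓡 n) (e.symm x) :=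
  mfderiv (𝓡 n) (𝓡 n) e.symm x v

/-- The components `vⁱ` in the chart `e` of a tangent vector `v` at `p`. -/
def coordOfVec (e : OpenPartialHomeomorph M (Coord n)) (p : M) (v : TangentSpace (𝓡 n) p) :
    Coord n :=
  mfderiv (𝓡 n) (𝓡 n) e p v

/-- The components `F^k(x, v)` in the chart `e` of an extended vector field `F`, that is, of a
rule which assigns to `(p, v) ∈ TM` a vector in `T_pM`. -/
def forceUp (e : OpenPartialHomeomorph M (Coord n))
    (F : ∀ p : M, TangentSpace (𝓡 n) p → TangentSpace (𝓡 n) p) (k : Fin n) (x v : Coord n) : ℝ :=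
  coordOfVec e (e.symm x) (F (e.symm x) (vecOfCoord e x v)) k

variable [RiemannianBundle (fun p : M => TangentSpace (𝓡 n) p)]

/-- The components `g_{ij}` of the metric tensor in the chart `e`. -/
def metricCoeff (e : OpenPartialHomeomorph M (Coord n)) (i j : Fin n) (x : Coord n) : ℝ :=
  inner ℝ (vecOfCoord e x (basisVec i)) (vecOfCoord e x (basisVec j))

/-- The components `g^{ij}` of the inverse metric tensor in the chart `e`. -/
def metricInv (e : OpenPartialHomeomorph M (Coord n)) (i j : Fin n) (x : Coord n) : ℝ :=
  (Matrix.of fun a b => metricCoeff e a b x)⁻¹ i j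

/-- The components `Γ^k_{ij}` of the metric (Levi-Civita) connection in the chart `e`. -/
def christoffel (e : OpenPartialHomeomorph M (Coord n)) (k i j : Fin n) (x : Coord n) : ℝ :=
  (1 / 2) * ∑ l, metricInv e k l x *
    (partialDeriv i (metricCoeff e j l) x + partialDeriv j (metricCoeff e i l) x
      - partialDeriv l (metricCoeff e i j) x)

/-! ### Extended tensor fields in a chart: functions of `(x, v)` -/

/-- Lowering an index: `w_i = ∑ g_{ij} w^j`. -/
def lower (e : OpenPartialHomeomorph M (Coord n)) (w : Fin n → Coord n → Coord n → ℝ)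
    (i : Fin n) (x v : Coord n) : ℝ :=
  ∑ j, metricCoeff e i j x * w j x v

/-- The covariant components `F_i` of the force field. -/
def forceDown (e : OpenPartialHomeomorph M (Coord n))
    (F : ∀ p : M, TangentSpace (𝓡 n) p → TangentSpace (𝓡 n) p) : Fin n → Coord n → Coord n → ℝ :=
  lower e (forceUp e F)

/-- The length `|v|` of a velocity vector. -/
def speed (e : OpenPartialHomeomorph M (Coord n)) (x v : Coord n) : ℝ :=
  Real.sqrt (∑ i, ∑ j, metricCoeff e i j x * v i * v j)

/-- The contravariant components `N^i = v^i / |v|`. -/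
def unitUp (e : OpenPartialHomeomorph M (Coord n)) (i : Fin n) (x v : Coord n) : ℝ :=
  v i / speed e x v

/-- The components `P^i_k = δ^i_k - N^i N_k` of the orthogonal projector onto the hyperplane
perpendicular to `v`. -/
def projector (e : OpenPartialHomeomorph M (Coord n)) (i k : Fin n) (x v : Coord n) : ℝ :=
  (if i = k then 1 else 0) - unitUp e i x v * lower e (unitUp e) k x v

/-- The velocity gradient `∇̃_j X = ∂X/∂v^j` of a component `X` of an extended tensor field
(it acts on each component separately, whatever the type of the tensor field). -/
def velGrad (j : Fin n) (X : Coord n → Coord n → ℝ) (x v : Coord n) : ℝ :=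
  partialDeriv j (fun w => X x w) v

/-- The spatial gradient of an extended covector field:
`∇_i X_j = ∂X_j/∂x^i - ∑ Γ^a_{ib} v^b ∂X_j/∂v^a - ∑ Γ^a_{ij} X_a`. -/
def spatialGrad (e : OpenPartialHomeomorph M (Coord n)) (i : Fin n)
    (X : Fin n → Coord n → Coord n → ℝ) (j : Fin n) (x v : Coord n) : ℝ :=
  partialDeriv i (fun y => X j y v) x
    - ∑ a, ∑ b, christoffel e a i b x * v b * velGrad a (X j) x v
    - ∑ a, christoffel e a i j x * X a x v

/-- The system of weak normality equations at the point of `TM` with coordinates `(x, v)` in the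
chart `e`. -/
structure WeakNormalityEquations (e : OpenPartialHomeomorph M (Coord n))
    (F : ∀ p : M, TangentSpace (𝓡 n) p → TangentSpace (𝓡 n) p) (x v : Coord n) : Prop where
  first : ∀ k : Fin n,
    ∑ i, ((speed e x v)⁻¹ * forceDown e F i x v
        + velGrad i (fun y w => ∑ j, unitUp e j y w * forceDown e F j y w) x v)
      * projector e i k x v = 0
  second : ∀ k : Fin n,
    ∑ i, ∑ j, (spatialGrad e i (forceDown e F) j x v + spatialGrad e j (forceDown e F) i x v
          - 2 * (speed e x v ^ 2)⁻¹ * forceDown e F i x v * forceDown e F j x v)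
        * unitUp e j x v * projector e i k x v
      + ∑ i, ∑ j, (forceUp e F j x v * velGrad j (forceDown e F i) x v / speed e x v
          - ∑ r, unitUp e r x v * unitUp e j x v * velGrad j (forceDown e F r) x v / speed e x v
              * forceDown e F i x v)
        * projector e i k x v = 0

/-! ### Newtonian dynamics -/

/-- `γ` is a trajectory, on the open set `J` of times, of the Newtonian dynamical system with
force field `F`: in all local coordinates
`ẍ^k + ∑ Γ^k_{ij} ẋ^i ẋ^j = F^k(x, ẋ)`. -/
structure IsTrajectory (F : ∀ p : M, TangentSpace (𝓡 n) p → TangentSpace (𝓡 n) p)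
    (γ : ℝ → M) (J : Set ℝ) : Prop where
  smooth : ContMDiffOn 𝓘(ℝ, ℝ) (𝓡 n) 2 γ J
  newton : ∀ t ∈ J, ∀ e ∈ IsManifold.maximalAtlas (𝓡 n) ∞ M, γ t ∈ e.source → ∀ k : Fin n,
    iteratedDeriv 2 (fun s => e (γ s) k) t
      + ∑ i, ∑ j, christoffel e k i j (e (γ t))
          * deriv (fun s => e (γ s) i) t * deriv (fun s => e (γ s) j) t
      = forceUp e F k (e (γ t)) (deriv (fun s => e (γ s)) t)

end Charts

section BlowUp

variable {m : ℕ} {M : Type*} [TopologicalSpace M] [ChartedSpace (Coord (m + 1)) M]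

instance finrankTangentSpace (p : M) :
    Fact (Module.finrank ℝ (TangentSpace (𝓡 (m + 1)) p) = m + 1) :=
  ⟨finrank_euclideanSpace_fin⟩

/-- The velocity of a curve in `M`, as a point of `TM`. -/
def velocity (γ : ℝ → M) (t : ℝ) : TangentBundle (𝓡 (m + 1)) M :=
  ⟨γ t, mfderiv 𝓘(ℝ, ℝ) (𝓡 (m + 1)) γ t (1 : ℝ)⟩

variable [RiemannianBundle (fun p : M => TangentSpace (𝓡 (m + 1)) p)]

/-- The unit sphere `σ` in `T_pM`. -/
abbrev UnitSphere (p : M) : Set (TangentSpace (𝓡 (m + 1)) p) := sphere 0 1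

/-- The family of maps `f_t : σ → M` (`q ↦ f q t`) is the blow-up of the point `p₀` along
trajectories of the Newtonian dynamical system with force field `F`, determined by the initial
data `x(0) = p₀`, `ẋ(0) = ν₀ n(q)`, where `n(q)` is the radius vector of `q ∈ σ`. The map `f_t` is
a diffeomorphism of `σ` onto a smooth hypersurface `S_t` of `M` for `0 < t < ε`. -/
structure IsBlowUp (F : ∀ p : M, TangentSpace (𝓡 (m + 1)) p → TangentSpace (𝓡 (m + 1)) p)
    (p₀ : M) (ν₀ ε : ℝ) (f : UnitSphere (m := m) p₀ → ℝ → M) : Prop where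
  smooth : ContMDiffOn ((𝓡 m).prod 𝓘(ℝ, ℝ)) (𝓡 (m + 1)) ∞
    (fun z : UnitSphere (m := m) p₀ × ℝ => f z.1 z.2) (univ ×ˢ Ioo (-ε) ε)
  initial : ∀ q, velocity (f q) 0 = ⟨p₀, ν₀ • (q : TangentSpace (𝓡 (m + 1)) p₀)⟩
  trajectory : ∀ q, IsTrajectory F (f q) (Ioo (-ε) ε)
  embedding : ∀ t ∈ Ioo 0 ε, IsSmoothEmbedding (𝓡 m) (𝓡 (m + 1)) ∞ (fun q => f q t)

/-- The hypersurfaces `S_t = f_t(σ)`, `0 < t < ε`, are orthogonal to the trajectories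
`t ↦ f q t`: the velocity is orthogonal to all vectors tangent to `S_t`. -/
def IsNormal (p₀ : M) (ε : ℝ) (f : UnitSphere (m := m) p₀ → ℝ → M) : Prop :=
  ∀ t ∈ Ioo 0 ε, ∀ (q : UnitSphere (m := m) p₀) (w : TangentSpace (𝓡 m) q),
    inner ℝ (velocity (f q) t).2
      (mfderiv (𝓡 m) (𝓡 (m + 1)) (fun q' => f q' t) q w : TangentSpace (𝓡 (m + 1)) (f q t)) = 0

/-- The Newtonian dynamical system with force field `F` admits normal blow-up of points. -/
def AdmitsNormalBlowUp
    (F : ∀ p : M, TangentSpace (𝓡 (m + 1)) p → TangentSpace (𝓡 (m + 1)) p) : Prop :=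
  ∀ (p₀ : M) (ν₀ : ℝ), 0 < ν₀ →
    ∃ ε > 0, ∃ f : UnitSphere (m := m) p₀ → ℝ → M, IsBlowUp F p₀ ν₀ ε f ∧ IsNormal p₀ ε f

end BlowUp

end NormalBlowUp

end

noncomputable section

namespace NormalBlowUp

/-! Write `K` for the kinetic energy in a chart, `α` for the force covector, `W = α(v)` for the
power and `S` for the vector field of the motion on phase space. The Christoffel symbols are such
that Newton's equations become Lagrange's: the time derivative of `∂K/∂v` is `∂K/∂x + α`
(`lagrange_equation`), and hence `dK(S) = W` (`energy_equation`).

Vary a trajectory by turning its initial velocity along a great circle. The variation `T = (τ, τ')`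
solves the linearized equations with `T(0) = (0, u)`, where `u` is orthogonal to the velocity
(`exists_variation`). Normality says that `φ = ∂K/∂v · τ`, the inner product of velocity and
variation, vanishes for `t > 0`. Lagrange's equations give `φ' = dK(T) + α(τ)`, and the
differentiated energy identity gives `φ'' = dW(T) + (α(τ))'`. Letting `t → 0` gives `φ''(0) = 0` and
`φ'''(0) = 0` (`variation_orders`).

The condition `φ''(0) = 0` reads `powerForm α z u = 0` for all `u` orthogonal to the velocity;
divided by the speed, it is the first equation (`first_equation_of_powerForm`). It holds at every
phase point with nonzero velocity, because the point and the speed are arbitrary, so `powerForm α =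
l · ∂K/∂v` with a differentiable function `l`. This relation may therefore be differentiated along
the motion, which removes the derivatives of `powerForm` and of the acceleration from `φ'''(0) = 0`
(`third_order_of_proportional`). Rewriting the rest with horizontal derivatives gives the second
equation (`second_equation_of_third_order`). -/

theorem two_le_infty : (2 : WithTop ℕ∞) ≤ ∞ := by
  change ((2 : ℕ∞) : WithTop ℕ∞) ≤ ((⊤ : ℕ∞) : WithTop ℕ∞)
  exact WithTop.coe_le_coe.2 le_top

/-! ### Expansion in time of the normality condition on a normed space -/

section Calculus

open Filter Topology

variable {G : Type*} [NormedAddCommGroup G] [NormedSpace ℝ G]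

/-- Normality is known only for positive times, while the conditions are read at time `0`: the value
there is a limit from the right, and the derivative equals the right derivative. -/
theorem eq_zero_and_deriv_eq_zero_of_eqOn_Ioo {h : ℝ → ℝ} {h' δ : ℝ} (hδ : 0 < δ)
    (hh : HasDerivAt h h' 0) (hz : ∀ t ∈ Ioo 0 δ, h t = 0) : h 0 = 0 ∧ h' = 0 := by
  have hev : h =ᶠ[𝓝[>] 0] fun _ => (0 : ℝ) := by
    filter_upwards [Ioo_mem_nhdsGT hδ] with t ht using hz t ht
  have h0 : h 0 = 0 := by
    have h1 : Tendsto h (𝓝[>] 0) (𝓝 (h 0)) := hh.continuousAt.tendsto.mono_left nhdsWithin_le_nhds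
    exact tendsto_nhds_unique (h1.congr' hev) tendsto_const_nhds
  refine ⟨h0, ?_⟩
  have h1 : HasDerivWithinAt h h' (Ioi 0) 0 := hh.hasDerivWithinAt
  have h2 : HasDerivWithinAt h 0 (Ioi 0) 0 :=
    (hasDerivWithinAt_const (0 : ℝ) (Ioi 0) (0 : ℝ)).congr_of_eventuallyEq hev h0
  exact (uniqueDiffWithinAt_Ioi (0 : ℝ)).eq_deriv _ h1 h2

/-- The second order vector field on `G × G` defined by an acceleration `a`. -/
def spray (a : G × G → G) (z : G × G) : G × G := (z.2, a z)

/-- The form `d_v(α(x, v) v) + α(x, v)` attached to a force covector `α`. -/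
def powerForm (α : G × G → G →L[ℝ] ℝ) (z : G × G) (u : G) : ℝ :=
  fderiv ℝ (fun z => α z z.2) z (0, u) + α z u

variable {U : Set (G × G)} {K : G × G → ℝ} {α : G × G → G →L[ℝ] ℝ} {a : G × G → G}

theorem hasFDerivAt_spray {z : G × G} (ha : DifferentiableAt ℝ a z) :
    HasFDerivAt (spray a) ((ContinuousLinearMap.snd ℝ G G).prod (fderiv ℝ a z)) z :=
  (hasFDerivAt_snd).prodMk ha.hasFDerivAt

theorem hasDerivAt_fderiv_comp {f : G × G → ℝ} (hU : IsOpen U) (hf : ContDiffOn ℝ ∞ f U)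
    {z T : ℝ → G × G} {z' T' : G × G} {t : ℝ} (hz : HasDerivAt z z' t) (hzU : z t ∈ U)
    (hT : HasDerivAt T T' t) :
    HasDerivAt (fun t => fderiv ℝ f (z t) (T t))
      (fderiv ℝ (fderiv ℝ f) (z t) z' (T t) + fderiv ℝ f (z t) T') t := by
  have h1 : DifferentiableAt ℝ (fderiv ℝ f) (z t) :=
    ((hf.fderiv_of_isOpen hU (m := ∞) (by simp)).contDiffAt (hU.mem_nhds hzU)).differentiableAt
      (by simp)
  exact (h1.hasFDerivAt.comp_hasDerivAt t hz).clm_apply hT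

theorem contDiffOn_power (hα : ContDiffOn ℝ ∞ α U) :
    ContDiffOn ℝ ∞ (fun z => α z z.2) U :=
  hα.clm_apply contDiffOn_snd

/-- Consequences, to second and third order in time, of the vanishing of
`t ↦ ∂K/∂v (z t) (T t).1` for positive times, for a solution `z` of the equations of motion with
kinetic energy `K` and force covector `α`, and a solution `T` of the linearized equations with
vanishing initial position. -/
theorem variation_orders (hU : IsOpen U) (hK : ContDiffOn ℝ ∞ K U) (hα : ContDiffOn ℝ ∞ α U)
    (ha : ContDiffOn ℝ ∞ a U)
    (henergy : ∀ z ∈ U, fderiv ℝ K z (spray a z) = α z z.2)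
    (hlagrange : ∀ z ∈ U, ∀ u, fderiv ℝ (fderiv ℝ K) z (spray a z) (0, u)
      = fderiv ℝ K z (u, 0) + α z u)
    {z T : ℝ → G × G} {δ : ℝ} (hδ : 0 < δ) (hzU : ∀ t ∈ Ioo (-δ) δ, z t ∈ U)
    (hz : ∀ t ∈ Ioo (-δ) δ, HasDerivAt z (spray a (z t)) t)
    (hT : ∀ t ∈ Ioo (-δ) δ, HasDerivAt T (fderiv ℝ (spray a) (z t) (T t)) t)
    (hφ : ∀ t ∈ Ioo 0 δ, fderiv ℝ K (z t) (0, (T t).1) = 0)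
    {u : G} (hu : T 0 = (0, u)) :
    powerForm α (z 0) u = 0 ∧
      fderiv ℝ (fun z => α z z.2) (z 0) (u, 0)
        + fderiv ℝ (fun z => powerForm α z u) (z 0) (spray a (z 0))
        + fderiv ℝ α (z 0) (spray a (z 0)) u
        + powerForm α (z 0) (fderiv ℝ a (z 0) (0, u)) = 0 := by
  have hpos : ∀ t ∈ Ioo 0 δ, t ∈ Ioo (-δ) δ := fun t ht => ⟨by linarith [ht.1], ht.2⟩
  have h0 : (0 : ℝ) ∈ Ioo (-δ) δ := ⟨by linarith, hδ⟩
  have hW := contDiffOn_power hα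
  have hαd : ∀ z ∈ U, DifferentiableAt ℝ α z := fun z hz =>
    (hα.contDiffAt (hU.mem_nhds hz)).differentiableAt (by simp)
  have had : ∀ z ∈ U, DifferentiableAt ℝ a z := fun z hz =>
    (ha.contDiffAt (hU.mem_nhds hz)).differentiableAt (by simp)
  have hdα : ContDiffOn ℝ ∞ (fderiv ℝ α) U := hα.fderiv_of_isOpen hU (by simp)
  have hdK : ContDiffOn ℝ ∞ (fderiv ℝ K) U := hK.fderiv_of_isOpen hU (by simp)
  have hdW : ContDiffOn ℝ ∞ (fderiv ℝ (fun z => α z z.2)) U := hW.fderiv_of_isOpen hU (by simp)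
  have hS : ContDiffOn ℝ ∞ (spray a) U := contDiffOn_snd.prodMk ha
  have hSd : ∀ z ∈ U, DifferentiableAt ℝ (spray a) z := fun z hz =>
    (hS.contDiffAt (hU.mem_nhds hz)).differentiableAt (by simp)
  have hT1 : ∀ t ∈ Ioo (-δ) δ, HasDerivAt (fun t => (T t).1) (T t).2 t := fun t ht => by
    have h := (hasFDerivAt_fst (p := T t)).comp_hasDerivAt t (hT t ht)
    rw [(hasFDerivAt_spray (had _ (hzU t ht))).fderiv] at h
    exact h
  have hT2 : ∀ t ∈ Ioo (-δ) δ, HasDerivAt (fun t => (T t).2) (fderiv ℝ a (z t) (T t)) t :=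
    fun t ht => by
    have h := (hasFDerivAt_snd (p := T t)).comp_hasDerivAt t (hT t ht)
    rw [(hasFDerivAt_spray (had _ (hzU t ht))).fderiv] at h
    exact h
  have hαT : ∀ t ∈ Ioo (-δ) δ, HasDerivAt (fun t => α (z t) (T t).1)
      (fderiv ℝ α (z t) (spray a (z t)) (T t).1 + α (z t) (T t).2) t := fun t ht =>
    ((hαd _ (hzU t ht)).hasFDerivAt.comp_hasDerivAt t (hz t ht)).clm_apply (hT1 t ht)
  -- first order
  have hQ1 : ∀ t ∈ Ioo 0 δ, fderiv ℝ K (z t) (T t) + α (z t) (T t).1 = 0 := fun t ht => by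
    have ht' := hpos t ht
    have h1 := hasDerivAt_fderiv_comp hU hK (hz t ht') (hzU t ht')
      ((hasDerivAt_const t (0 : G)).prodMk (hT1 t ht'))
    rw [hlagrange _ (hzU t ht')] at h1
    have h2 : (fun t => fderiv ℝ K (z t) (0, (T t).1)) =ᶠ[𝓝 t] fun _ => 0 := by
      filter_upwards [Ioo_mem_nhds ht.1 ht.2] with s hs using hφ s hs
    have h3 := h1.unique ((hasDerivAt_const t (0 : ℝ)).congr_of_eventuallyEq h2)
    have h4 : fderiv ℝ K (z t) (T t)
        = fderiv ℝ K (z t) ((T t).1, 0) + fderiv ℝ K (z t) (0, (T t).2) := by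
      rw [← map_add]; simp
    rw [h4]; linarith
  -- the energy identity, differentiated
  have hE2 : ∀ z ∈ U, ∀ w, fderiv ℝ (fderiv ℝ K) z (spray a z) w
      + fderiv ℝ K z (fderiv ℝ (spray a) z w) = fderiv ℝ (fun z => α z z.2) z w := by
    intro z hzz w
    have h1 : (fun z => fderiv ℝ K z (spray a z)) =ᶠ[𝓝 z] fun z => α z z.2 := by
      filter_upwards [hU.mem_nhds hzz] with y hy using henergy y hy
    have hd : DifferentiableAt ℝ (fderiv ℝ K) z :=
      (hdK.contDiffAt (hU.mem_nhds hzz)).differentiableAt (by simp)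
    have h2 := (hd.hasFDerivAt.clm_apply (hSd z hzz).hasFDerivAt).fderiv
    rw [← h1.fderiv_eq, h2]
    -- Differentiating `dK(S)` in the direction `w` produces `D²K(w, S)`; symmetry turns it into
    -- `D²K(S, w)`, the form in which it occurs when `dK(T)` is differentiated along the motion.
    have hsymm : IsSymmSndFDerivAt ℝ K z :=
      (hK.contDiffAt (hU.mem_nhds hzz)).isSymmSndFDerivAt
        (by simpa using two_le_infty)
    simp [hsymm.eq (spray a z) w, add_comm]
  have hQ2 : ∀ t ∈ Ioo 0 δ, fderiv ℝ (fun z => α z z.2) (z t) (T t)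
      + (fderiv ℝ α (z t) (spray a (z t)) (T t).1 + α (z t) (T t).2) = 0 := fun t ht => by
    have ht' := hpos t ht
    have h1 := (hasDerivAt_fderiv_comp hU hK (hz t ht') (hzU t ht') (hT t ht')).add (hαT t ht')
    rw [hE2 _ (hzU t ht')] at h1
    refine h1.unique ((hasDerivAt_const t (0 : ℝ)).congr_of_eventuallyEq ?_)
    filter_upwards [Ioo_mem_nhds ht.1 ht.2] with s hs using hQ1 s hs
  -- third order
  have hz0 := hzU 0 h0
  -- The value of this derivative plays no role: in the product rule it is applied to `(T 0).1 = 0`.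
  have hβ : HasDerivAt (fun t => fderiv ℝ α (z t) (spray a (z t)))
      (fderiv ℝ (fun z => fderiv ℝ α z (spray a z)) (z 0) (spray a (z 0))) 0 := by
    have : DifferentiableAt ℝ (fun z => fderiv ℝ α z (spray a z)) (z 0) :=
      ((hdα.clm_apply hS).contDiffAt (hU.mem_nhds hz0)).differentiableAt (by simp)
    exact this.hasFDerivAt.comp_hasDerivAt 0 (hz 0 h0)
  have hα2 : HasDerivAt (fun t => α (z t) (T t).2)
      (fderiv ℝ α (z 0) (spray a (z 0)) (T 0).2 + α (z 0) (fderiv ℝ a (z 0) (T 0))) 0 :=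
    ((hαd _ hz0).hasFDerivAt.comp_hasDerivAt 0 (hz 0 h0)).clm_apply (hT2 0 h0)
  have hlast := (hasDerivAt_fderiv_comp hU hW (hz 0 h0) hz0 (hT 0 h0)).add
    ((hβ.clm_apply (hT1 0 h0)).add hα2)
  obtain ⟨e1, e2⟩ := eq_zero_and_deriv_eq_zero_of_eqOn_Ioo hδ hlast hQ2
  have hSu : fderiv ℝ (spray a) (z 0) (0, u) = (u, fderiv ℝ a (z 0) (0, u)) := by
    rw [(hasFDerivAt_spray (had _ hz0)).fderiv]; rfl
  simp only [Pi.add_apply, hu, map_zero, zero_add] at e1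
  refine ⟨e1, ?_⟩
  have hB : fderiv ℝ (fun z => powerForm α z u) (z 0) (spray a (z 0))
      = fderiv ℝ (fderiv ℝ (fun z => α z z.2)) (z 0) (spray a (z 0)) (0, u)
        + fderiv ℝ α (z 0) (spray a (z 0)) u := by
    have hd : DifferentiableAt ℝ (fderiv ℝ (fun z => α z z.2)) (z 0) :=
      (hdW.contDiffAt (hU.mem_nhds hz0)).differentiableAt (by simp)
    have h := ((hd.hasFDerivAt.clm_apply (hasFDerivAt_const ((0 : G), u) (z 0))).add
      ((hαd _ hz0).hasFDerivAt.clm_apply (hasFDerivAt_const u (z 0)))).fderiv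
    have h' : fderiv ℝ (fun z => powerForm α z u) (z 0) = _ := h
    rw [h']; simp
  rw [hB]
  have hsplit : (u, fderiv ℝ a (z 0) (0, u)) = ((u, 0) : G × G) + (0, fderiv ℝ a (z 0) (0, u)) := by
    simp
  rw [hu, hSu, hsplit, map_add] at e2
  simp only [map_zero, zero_add] at e2
  simp only [powerForm]
  linarith

/-- If moreover `powerForm α` is pointwise proportional to `∂K/∂v`, the third order condition
simplifies. -/
theorem third_order_of_proportional (hU : IsOpen U) (hK : ContDiffOn ℝ ∞ K U)
    (ha : ContDiffOn ℝ ∞ a U)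
    (henergy : ∀ z ∈ U, fderiv ℝ K z (spray a z) = α z z.2)
    (hlagrange : ∀ z ∈ U, ∀ u, fderiv ℝ (fderiv ℝ K) z (spray a z) (0, u)
      = fderiv ℝ K z (u, 0) + α z u)
    {l : G × G → ℝ} (hl : DifferentiableOn ℝ l U)
    (hprop : ∀ z ∈ U, ∀ u, powerForm α z u = l z * fderiv ℝ K z (0, u))
    {z : G × G} (hz : z ∈ U) {u : G} (hu : fderiv ℝ K z (0, u) = 0)
    (h3 : fderiv ℝ (fun z => α z z.2) z (u, 0)
        + fderiv ℝ (fun z => powerForm α z u) z (spray a z)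
        + fderiv ℝ α z (spray a z) u + powerForm α z (fderiv ℝ a z (0, u)) = 0) :
    fderiv ℝ (fun z => α z z.2) z (u, 0) + fderiv ℝ α z (spray a z) u
      - l z * (α z u + fderiv ℝ K z (u, 0)) = 0 := by
  have hdK : DifferentiableAt ℝ (fderiv ℝ K) z :=
    ((hK.fderiv_of_isOpen hU (m := ∞) (by simp)).contDiffAt (hU.mem_nhds hz)).differentiableAt
      (by simp)
  have had : DifferentiableAt ℝ a z :=
    (ha.contDiffAt (hU.mem_nhds hz)).differentiableAt (by simp)
  have hSd := (hasFDerivAt_spray had)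
  -- The term with the derivative of `l` carries the factor `∂K/∂v · u = 0`; the other one is given
  -- by Lagrange's equations.
  have hB : fderiv ℝ (fun z => powerForm α z u) z (spray a z)
      = l z * (fderiv ℝ K z (u, 0) + α z u) := by
    have h1 : (fun z => powerForm α z u) =ᶠ[𝓝 z] fun z => l z * fderiv ℝ K z (0, u) := by
      filter_upwards [hU.mem_nhds hz] with y hy using hprop y hy u
    have hlz : DifferentiableAt ℝ l z := (hl z hz).differentiableAt (hU.mem_nhds hz)
    have h2 := (hlz.hasFDerivAt.mul
      (hdK.hasFDerivAt.clm_apply (hasFDerivAt_const ((0 : G), u) z))).fderiv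
    rw [h1.fderiv_eq, ← hlagrange z hz u]
    erw [h2]
    simp [hu]
  have hE2 : fderiv ℝ (fderiv ℝ K) z (spray a z) (0, u)
      + fderiv ℝ K z (u, fderiv ℝ a z (0, u)) = fderiv ℝ (fun z => α z z.2) z (0, u) := by
    have h1 : (fun z => fderiv ℝ K z (spray a z)) =ᶠ[𝓝 z] fun z => α z z.2 := by
      filter_upwards [hU.mem_nhds hz] with y hy using henergy y hy
    have h2 := (hdK.hasFDerivAt.clm_apply hSd).fderiv
    rw [← h1.fderiv_eq, h2]
    have hsymm : IsSymmSndFDerivAt ℝ K z :=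
      (hK.contDiffAt (hU.mem_nhds hz)).isSymmSndFDerivAt
        (by simpa using two_le_infty)
    simp [hsymm.eq (spray a z) (0, u), add_comm]
  have hW : fderiv ℝ (fun z => α z z.2) z (0, u) = - α z u := by
    have := hprop z hz u
    rw [hu, mul_zero, powerForm] at this
    linarith
  have hsplit : fderiv ℝ K z (u, fderiv ℝ a z (0, u))
      = fderiv ℝ K z (u, 0) + fderiv ℝ K z (0, fderiv ℝ a z (0, u)) := by
    rw [← map_add]; simp
  rw [hlagrange z hz, hsplit, hW] at hE2
  rw [hB, hprop z hz] at h3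
  have : fderiv ℝ K z (0, fderiv ℝ a z (0, u)) = -2 * (fderiv ℝ K z (u, 0) + α z u) := by
    linarith
  -- The contributions to the coefficient of `l` are `+1` from differentiating along the motion and
  -- `-2` from the acceleration, whence the sign in the conclusion.
  rw [this] at h3
  linarith

end Calculus

/-! ### Tangent vectors, force and metric in a chart -/

section ChartGeometry

/-- The coordinate domain of the nonzero tangent vectors. -/
def phaseDomain {n : ℕ} {M : Type*} [TopologicalSpace M]
    (e : OpenPartialHomeomorph M (Coord n)) : Set (Coord n × Coord n) :=
  e.target ×ˢ {0}ᶜ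

theorem isOpen_phaseDomain {n : ℕ} {M : Type*} [TopologicalSpace M]
    {e : OpenPartialHomeomorph M (Coord n)} : IsOpen (phaseDomain e) :=
  e.open_target.prod isOpen_compl_singleton

variable {n : ℕ} {M : Type*} [TopologicalSpace M] [ChartedSpace (Coord n) M]
  {e : OpenPartialHomeomorph M (Coord n)}

theorem chart_mdifferentiable (he : e ∈ IsManifold.maximalAtlas (𝓡 n) ∞ M) :
    e.MDifferentiable (𝓡 n) (𝓡 n) :=
  ⟨(contMDiffOn_of_mem_maximalAtlas he).mdifferentiableOn (by simp),
    (contMDiffOn_symm_of_mem_maximalAtlas he).mdifferentiableOn (by simp)⟩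

theorem coordOfVec_vecOfCoord (he : e ∈ IsManifold.maximalAtlas (𝓡 n) ∞ M) {x : Coord n}
    (hx : x ∈ e.target) (v : Coord n) : coordOfVec e (e.symm x) (vecOfCoord e x v) = v :=
  congrArg (fun L => L v) ((chart_mdifferentiable he).comp_symm_deriv hx)

theorem vecOfCoord_coordOfVec (he : e ∈ IsManifold.maximalAtlas (𝓡 n) ∞ M) {x : Coord n}
    (hx : x ∈ e.target) (w : TangentSpace (𝓡 n) (e.symm x)) :
    vecOfCoord e x (coordOfVec e (e.symm x) w) = w := by
  have h := congrArg (fun L => L w)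
    ((chart_mdifferentiable he).symm_comp_deriv (e.map_target hx))
  have h2 : e (e.symm x) = x := e.right_inv hx
  change mfderiv (𝓡 n) (𝓡 n) e.symm (e (e.symm x)) (coordOfVec e (e.symm x) w) = w at h
  rw [h2] at h
  exact h

theorem vecOfCoord_ne_zero (he : e ∈ IsManifold.maximalAtlas (𝓡 n) ∞ M) {x : Coord n}
    (hx : x ∈ e.target) {v : Coord n} (hv : v ≠ 0) : vecOfCoord e x v ≠ 0 := fun h => hv <| by
  rw [← coordOfVec_vecOfCoord he hx v, h]
  exact map_zero (mfderiv (𝓡 n) (𝓡 n) e (e.symm x))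

/-- This is the tangent map of `e.symm`, after the tangent bundle of the model space is identified
with a product. -/
theorem contMDiffOn_vecOfCoord [IsManifold (𝓡 n) ∞ M]
    (he : e ∈ IsManifold.maximalAtlas (𝓡 n) ∞ M) :
    ContMDiffOn 𝓘(ℝ, Coord n × Coord n) (𝓡 n).tangent ∞
      (fun z : Coord n × Coord n =>
        (⟨e.symm z.1, vecOfCoord e z.1 z.2⟩ : TangentBundle (𝓡 n) M)) (e.target ×ˢ univ) := by
  have h1 := (contMDiffOn_symm_of_mem_maximalAtlas he).contMDiffOn_tangentMapWithin
    (m := ∞) (by simp) e.open_target.uniqueMDiffOn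
  have h2 : ContMDiff 𝓘(ℝ, Coord n × Coord n) (𝓡 n).tangent ∞
      (fun z : Coord n × Coord n => (⟨z.1, z.2⟩ : TangentBundle (𝓡 n) (Coord n))) := by
    intro z
    rw [Bundle.contMDiffAt_totalSpace]
    refine ⟨contDiff_fst.contMDiff.contMDiffAt, ?_⟩
    have : ContMDiffAt 𝓘(ℝ, Coord n × Coord n) 𝓘(ℝ, Coord n) ∞
      (fun z : Coord n × Coord n => z.2) z := contDiff_snd.contMDiff.contMDiffAt
    convert! this with y
    simp
    rfl
  refine (h1.comp h2.contMDiffOn (s := e.target ×ˢ univ) fun z hz => hz.1).congr fun z hz => ?_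
  have : mfderivWithin (𝓡 n) (𝓡 n) e.symm e.target z.1 = mfderiv (𝓡 n) (𝓡 n) e.symm z.1 :=
    mfderivWithin_of_isOpen e.open_target hz.1
  simp only [Function.comp, tangentMapWithin, this]
  rfl

theorem contMDiffOn_coordOfVec [IsManifold (𝓡 n) ∞ M]
    (he : e ∈ IsManifold.maximalAtlas (𝓡 n) ∞ M) :
    ContMDiffOn (𝓡 n).tangent 𝓘(ℝ, Coord n) ∞
      (fun q : TangentBundle (𝓡 n) M => coordOfVec e q.proj q.snd)
      (TotalSpace.proj ⁻¹' e.source) := by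
  have h1 := (contMDiffOn_of_mem_maximalAtlas he).contMDiffOn_tangentMapWithin
    (m := ∞) (by simp) e.open_source.uniqueMDiffOn
  refine ((contMDiff_snd_tangentBundle_modelSpace (Coord n) (𝓡 n)).comp_contMDiffOn h1).congr
    fun q hq => ?_
  have : mfderivWithin (𝓡 n) (𝓡 n) e e.source q.proj = mfderiv (𝓡 n) (𝓡 n) e q.proj :=
    mfderivWithin_of_isOpen e.open_source hq
  simp only [Function.comp, tangentMapWithin, this]
  rfl

theorem contDiffOn_forceUp [IsManifold (𝓡 n) ∞ M]
    (he : e ∈ IsManifold.maximalAtlas (𝓡 n) ∞ M)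
    {F : ∀ p : M, TangentSpace (𝓡 n) p → TangentSpace (𝓡 n) p}
    (hF : ContMDiffOn (𝓡 n).tangent (𝓡 n).tangent ∞
      (fun q : TangentBundle (𝓡 n) M => (⟨q.proj, F q.proj q.snd⟩ : TangentBundle (𝓡 n) M))
      {q | q.snd ≠ 0}) (k : Fin n) :
    ContDiffOn ℝ ∞ (fun z : Coord n × Coord n => forceUp e F k z.1 z.2) (phaseDomain e) := by
  have h1 : ContMDiffOn 𝓘(ℝ, Coord n × Coord n) (𝓡 n).tangent ∞ _ (phaseDomain e) :=
    hF.comp ((contMDiffOn_vecOfCoord he).mono fun z hz => ⟨hz.1, trivial⟩)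
      fun z hz => vecOfCoord_ne_zero he hz.1 hz.2
  have h2 := (contMDiffOn_coordOfVec he).comp h1 fun z hz => e.map_target hz.1
  have h3 : ContDiffOn ℝ ∞ _ (phaseDomain e) := contMDiffOn_iff_contDiffOn.1 h2
  exact (contDiff_euclidean.1 contDiff_id k).comp_contDiffOn h3

variable [RiemannianBundle (fun p : M => TangentSpace (𝓡 n) p)]

theorem sum_smul_basisVec (v : Coord n) : ∑ i, v i • basisVec i = v := by
  ext j; simp [Finset.sum_apply, Pi.single_apply]

theorem metricCoeff_symm (i j : Fin n) (x : Coord n) :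
    metricCoeff e i j x = metricCoeff e j i x := real_inner_comm _ _

theorem sum_metricCoeff (x v w : Coord n) :
    ∑ i, ∑ j, metricCoeff e i j x * v i * w j = inner ℝ (vecOfCoord e x v) (vecOfCoord e x w) := by
  have key : ∀ v : Coord n, vecOfCoord e x v = ∑ i, v i • vecOfCoord e x (basisVec i) := by
    intro v
    conv_lhs => rw [← sum_smul_basisVec v]
    have := map_sum (mfderiv (𝓡 n) (𝓡 n) e.symm x) (fun i => v i • basisVec i) Finset.univ
    refine this.trans (Finset.sum_congr rfl fun i _ => ?_)
    exact map_smul (mfderiv (𝓡 n) (𝓡 n) e.symm x) (v i) (basisVec i)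
  rw [key v, key w, sum_inner]
  refine Finset.sum_congr rfl fun i _ => ?_
  rw [inner_sum]
  refine Finset.sum_congr rfl fun j _ => ?_
  rw [real_inner_smul_left, real_inner_smul_right, metricCoeff]
  ring

theorem sum_metricCoeff_coordOfVec (he : e ∈ IsManifold.maximalAtlas (𝓡 n) ∞ M) {p : M}
    (hp : p ∈ e.source) (v w : TangentSpace (𝓡 n) p) :
    ∑ i, ∑ j, metricCoeff e i j (e p) * coordOfVec e p v i * coordOfVec e p w j
      = inner ℝ v w := by
  obtain ⟨x, hx, rfl⟩ : ∃ x, x ∈ e.target ∧ p = e.symm x :=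
    ⟨e p, e.map_source hp, (e.left_inv hp).symm⟩
  rw [e.right_inv hx, sum_metricCoeff, vecOfCoord_coordOfVec he hx, vecOfCoord_coordOfVec he hx]

theorem sum_metricCoeff_pos (he : e ∈ IsManifold.maximalAtlas (𝓡 n) ∞ M) {x v : Coord n}
    (hx : x ∈ e.target) (hv : v ≠ 0) : 0 < ∑ i, ∑ j, metricCoeff e i j x * v i * v j := by
  rw [sum_metricCoeff]
  exact real_inner_self_pos.2 (vecOfCoord_ne_zero he hx hv)

theorem contDiffOn_metricCoeff [IsManifold (𝓡 n) ∞ M]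
    [IsContMDiffRiemannianBundle (𝓡 n) ∞ (Coord n) (fun p : M => TangentSpace (𝓡 n) p)]
    (he : e ∈ IsManifold.maximalAtlas (𝓡 n) ∞ M) (i j : Fin n) :
    ContDiffOn ℝ ∞ (metricCoeff e i j) e.target := by
  have h : ∀ i : Fin n, ContMDiffOn (𝓡 n) (𝓡 n).tangent ∞
      (fun x : Coord n => (⟨e.symm x, vecOfCoord e x (basisVec i)⟩ : TangentBundle (𝓡 n) M))
      e.target := fun i =>
    (contMDiffOn_vecOfCoord he).comp (contMDiff_id.prodMk_space contMDiff_const).contMDiffOn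
      fun x hx => ⟨hx, trivial⟩
  exact contMDiffOn_iff_contDiffOn.1 ((h i).inner_bundle (h j))

/-- A kernel vector of the Gram matrix would be a nonzero tangent vector of length zero. -/
theorem isUnit_det_metricCoeff (he : e ∈ IsManifold.maximalAtlas (𝓡 n) ∞ M) {x : Coord n}
    (hx : x ∈ e.target) : IsUnit (Matrix.of fun a b => metricCoeff e a b x).det := by
  rw [isUnit_iff_ne_zero]
  intro h
  obtain ⟨v, hv, hgv⟩ := Matrix.exists_mulVec_eq_zero_iff.2 h
  have hv' : WithLp.toLp 2 v ≠ 0 := fun h => hv (by simpa using h)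
  refine (sum_metricCoeff_pos he hx hv').ne' ?_
  have : ∀ i, ∑ j, metricCoeff e i j x * v j = 0 := fun i => by
    simpa [Matrix.mulVec, dotProduct] using congrFun hgv i
  refine Finset.sum_eq_zero fun i _ => ?_
  rw [← mul_zero (v i), ← this i, Finset.mul_sum]
  refine Finset.sum_congr rfl fun j _ => ?_
  simp only
  ring

theorem sum_metricCoeff_mul_metricInv (he : e ∈ IsManifold.maximalAtlas (𝓡 n) ∞ M) {x : Coord n}
    (hx : x ∈ e.target) (i j : Fin n) :
    ∑ k, metricCoeff e i k x * metricInv e k j x = if i = j then 1 else 0 := by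
  have h := congrFun (congrFun (Matrix.mul_nonsing_inv _ (isUnit_det_metricCoeff he hx)) i) j
  simpa [Matrix.mul_apply, Matrix.one_apply, metricInv] using h

/-- By Cramer's rule the inverse is the adjugate over the determinant, both polynomial in the metric
coefficients. -/
theorem contDiffOn_metricInv [IsManifold (𝓡 n) ∞ M]
    [IsContMDiffRiemannianBundle (𝓡 n) ∞ (Coord n) (fun p : M => TangentSpace (𝓡 n) p)]
    (he : e ∈ IsManifold.maximalAtlas (𝓡 n) ∞ M) (i j : Fin n) :
    ContDiffOn ℝ ∞ (metricInv e i j) e.target := by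
  have hdet : ∀ f : Matrix (Fin n) (Fin n) (Coord n → ℝ),
      (∀ i j, ContDiffOn ℝ ∞ (f i j) e.target) →
      ContDiffOn ℝ ∞ (fun x => (Matrix.of fun a b => f a b x).det) e.target := by
    intro f hf
    simp only [Matrix.det_apply]
    exact ContDiffOn.sum fun σ _ => (contDiffOn_prod fun i _ => hf _ _).const_smul _
  have hadj : ContDiffOn ℝ ∞
      (fun x => (Matrix.of fun a b => metricCoeff e a b x).adjugate i j) e.target := by
    simp only [Matrix.adjugate_apply]
    -- An adjugate entry is the determinant of the matrix with row `j` replaced by the `i`-th unit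
    -- vector.
    refine (hdet (fun a b x => (if a = j then Pi.single (M := fun _ => ℝ) i 1 b
      else metricCoeff e a b x)) fun a b => ?_).congr fun x _ => ?_
    · by_cases h : a = j
      · simp only [h, if_true]; exact contDiffOn_const
      · simp only [h, if_false]; exact contDiffOn_metricCoeff he a b
    · congr 1
      ext a b
      by_cases h : a = j
      · subst h; simp
      · simp [h]
  refine ((hdet (fun a b => metricCoeff e a b) fun a b => contDiffOn_metricCoeff he a b).inv
    (fun x hx => (isUnit_det_metricCoeff he hx).ne_zero)).mul hadj |>.congr fun x hx => ?_
  simp [metricInv, Matrix.inv_def, Ring.inverse_eq_inv']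

end ChartGeometry

/-! ### Newton's equations as Lagrange equations of the kinetic energy -/

section CoordinateDynamics

variable {n : ℕ} {M : Type*} [TopologicalSpace M] [ChartedSpace (Coord n) M]
  {e : OpenPartialHomeomorph M (Coord n)}

theorem sum_mul_apply_basisVec (L : Coord n →L[ℝ] ℝ) (v : Coord n) :
    ∑ i, v i * L (basisVec i) = L v := by
  conv_rhs => rw [← sum_smul_basisVec v, map_sum]
  simp

variable [RiemannianBundle (fun p : M => TangentSpace (𝓡 n) p)]

/-- The kinetic energy in the chart `e`. -/
def kinetic (e : OpenPartialHomeomorph M (Coord n)) (z : Coord n × Coord n) : ℝ :=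
  (1 / 2) * ∑ i, ∑ j, metricCoeff e i j z.1 * z.2 i * z.2 j

/-- The force, as a covector on coordinate space. -/
def forceForm (e : OpenPartialHomeomorph M (Coord n))
    (F : ∀ p : M, TangentSpace (𝓡 n) p → TangentSpace (𝓡 n) p) (z : Coord n × Coord n) :
    Coord n →L[ℝ] ℝ :=
  ∑ i, forceDown e F i z.1 z.2 • (EuclideanSpace.proj i : Coord n →L[ℝ] ℝ)

/-- The right-hand side of the equations of motion, solved for the second derivatives. -/
def acceleration (e : OpenPartialHomeomorph M (Coord n))
    (F : ∀ p : M, TangentSpace (𝓡 n) p → TangentSpace (𝓡 n) p) (z : Coord n × Coord n) :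
    Coord n :=
  WithLp.toLp 2 fun k => forceUp e F k z.1 z.2
    - ∑ i, ∑ j, christoffel e k i j z.1 * z.2 i * z.2 j

variable {F : ∀ p : M, TangentSpace (𝓡 n) p → TangentSpace (𝓡 n) p}

theorem forceForm_apply (z : Coord n × Coord n) (u : Coord n) :
    forceForm e F z u = ∑ i, forceDown e F i z.1 z.2 * u i := by
  simp [forceForm]

theorem christoffel_symm (k i j : Fin n) (x : Coord n) :
    christoffel e k i j x = christoffel e k j i x := by
  have h : metricCoeff e i j = metricCoeff e j i := funext fun x => metricCoeff_symm i j x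
  simp only [christoffel, h]
  congr 1
  refine Finset.sum_congr rfl fun l _ => ?_
  ring

theorem sum_metricCoeff_mul_christoffel (he : e ∈ IsManifold.maximalAtlas (𝓡 n) ∞ M)
    {x : Coord n} (hx : x ∈ e.target) (l i j : Fin n) :
    ∑ k, metricCoeff e l k x * christoffel e k i j x
      = (1 / 2) * (partialDeriv i (metricCoeff e j l) x + partialDeriv j (metricCoeff e i l) x
        - partialDeriv l (metricCoeff e i j) x) := by
  simp only [christoffel, Finset.mul_sum]
  rw [Finset.sum_comm]
  have : ∀ r, ∑ k, metricCoeff e l k x * (1 / 2 * (metricInv e k r x *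
      (partialDeriv i (metricCoeff e j r) x + partialDeriv j (metricCoeff e i r) x
        - partialDeriv r (metricCoeff e i j) x)))
      = (if l = r then 1 else 0) * (1 / 2 *
      (partialDeriv i (metricCoeff e j r) x + partialDeriv j (metricCoeff e i r) x
        - partialDeriv r (metricCoeff e i j) x)) := fun r => by
    rw [← sum_metricCoeff_mul_metricInv he hx l r, Finset.sum_mul]
    exact Finset.sum_congr rfl fun k _ => by ring
  rw [Finset.sum_congr rfl fun r _ => this r]
  simp

/-- `∑ g_{lk} w^l Γ^k_{ij} u^i y^j` in terms of derivatives of the metric. -/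
theorem sum_christoffel_contract (he : e ∈ IsManifold.maximalAtlas (𝓡 n) ∞ M)
    {x : Coord n} (hx : x ∈ e.target) (w u y : Coord n) :
    ∑ l, ∑ k, metricCoeff e l k x * w l * (∑ i, ∑ j, christoffel e k i j x * u i * y j)
      = (1 / 2) * ((∑ i, ∑ j, fderiv ℝ (metricCoeff e i j) x u * y i * w j)
        + (∑ i, ∑ j, fderiv ℝ (metricCoeff e i j) x y * u i * w j)
        - (∑ i, ∑ j, fderiv ℝ (metricCoeff e i j) x w * u i * y j)) := by
  have h1 : ∀ l, ∑ k, metricCoeff e l k x * w l * (∑ i, ∑ j, christoffel e k i j x * u i * y j)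
      = ∑ i, ∑ j, (1 / 2) * (partialDeriv i (metricCoeff e j l) x
        + partialDeriv j (metricCoeff e i l) x
        - partialDeriv l (metricCoeff e i j) x) * u i * y j * w l := fun l => by
    simp only [← sum_metricCoeff_mul_christoffel he hx, Finset.mul_sum, Finset.sum_mul]
    rw [Finset.sum_comm]
    refine Finset.sum_congr rfl fun i _ => ?_
    rw [Finset.sum_comm]
    exact Finset.sum_congr rfl fun j _ => Finset.sum_congr rfl fun k _ => by ring
  rw [Finset.sum_congr rfl fun l _ => h1 l]
  have e1 : ∑ i, ∑ j, fderiv ℝ (metricCoeff e i j) x u * y i * w j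
      = ∑ l, ∑ i, ∑ j, partialDeriv i (metricCoeff e j l) x * u i * y j * w l := by
    rw [Finset.sum_comm]
    refine Finset.sum_congr rfl fun l _ => ?_
    rw [Finset.sum_comm]
    refine Finset.sum_congr rfl fun j _ => ?_
    rw [← sum_mul_apply_basisVec, Finset.sum_mul, Finset.sum_mul]
    exact Finset.sum_congr rfl fun i _ => by rw [partialDeriv]; ring
  have e2 : ∑ i, ∑ j, fderiv ℝ (metricCoeff e i j) x y * u i * w j
      = ∑ l, ∑ i, ∑ j, partialDeriv j (metricCoeff e i l) x * u i * y j * w l := by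
    rw [Finset.sum_comm]
    refine Finset.sum_congr rfl fun l _ => Finset.sum_congr rfl fun i _ => ?_
    rw [← sum_mul_apply_basisVec, Finset.sum_mul, Finset.sum_mul]
    exact Finset.sum_congr rfl fun j _ => by rw [partialDeriv]; ring
  have e3 : ∑ i, ∑ j, fderiv ℝ (metricCoeff e i j) x w * u i * y j
      = ∑ l, ∑ i, ∑ j, partialDeriv l (metricCoeff e i j) x * u i * y j * w l := by
    rw [Finset.sum_comm]
    conv_rhs => rw [Finset.sum_comm]; enter [2, i]; rw [Finset.sum_comm]
    rw [Finset.sum_comm]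
    refine Finset.sum_congr rfl fun i _ => Finset.sum_congr rfl fun j _ => ?_
    rw [← sum_mul_apply_basisVec, Finset.sum_mul, Finset.sum_mul]
    exact Finset.sum_congr rfl fun l _ => by rw [partialDeriv]; ring
  rw [e1, e2, e3]
  simp only [← Finset.sum_add_distrib, ← Finset.sum_sub_distrib, Finset.mul_sum]
  exact Finset.sum_congr rfl fun l _ => Finset.sum_congr rfl fun i _ =>
    Finset.sum_congr rfl fun j _ => by ring

theorem sum_sum_symm_swap {f : Fin n → Fin n → ℝ} (hf : ∀ i j, f i j = f j i) (u w : Coord n) :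
    ∑ i, ∑ j, f i j * u i * w j = ∑ i, ∑ j, f i j * w i * u j := by
  rw [Finset.sum_comm]
  exact Finset.sum_congr rfl fun i _ => Finset.sum_congr rfl fun j _ => by rw [hf]; ring

theorem fderiv_metricCoeff_symm (i j : Fin n) (x : Coord n) :
    fderiv ℝ (metricCoeff e i j) x = fderiv ℝ (metricCoeff e j i) x := by
  have h : metricCoeff e i j = metricCoeff e j i := funext fun x => metricCoeff_symm i j x
  rw [h]

section Smooth

variable [IsManifold (𝓡 n) ∞ M]
  [IsContMDiffRiemannianBundle (𝓡 n) ∞ (Coord n) (fun p : M => TangentSpace (𝓡 n) p)]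

theorem contDiffOn_metricCoeff_phase (he : e ∈ IsManifold.maximalAtlas (𝓡 n) ∞ M) (i j : Fin n) :
    ContDiffOn ℝ ∞ (fun z : Coord n × Coord n => metricCoeff e i j z.1) (phaseDomain e) :=
  (contDiffOn_metricCoeff he i j).comp contDiffOn_fst fun _ hz => hz.1

theorem contDiffOn_coord_snd (i : Fin n) (s : Set (Coord n × Coord n)) :
    ContDiffOn ℝ ∞ (fun z : Coord n × Coord n => z.2 i) s :=
  (((EuclideanSpace.proj i : Coord n →L[ℝ] ℝ).contDiff).comp contDiff_snd).contDiffOn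

theorem contDiffOn_kinetic (he : e ∈ IsManifold.maximalAtlas (𝓡 n) ∞ M) :
    ContDiffOn ℝ ∞ (kinetic e) (phaseDomain e) :=
  contDiffOn_const.mul <| ContDiffOn.sum fun i _ => ContDiffOn.sum fun j _ =>
    ((contDiffOn_metricCoeff_phase he i j).mul (contDiffOn_coord_snd i _)).mul
      (contDiffOn_coord_snd j _)

theorem contDiffOn_christoffel (he : e ∈ IsManifold.maximalAtlas (𝓡 n) ∞ M) (k i j : Fin n) :
    ContDiffOn ℝ ∞ (christoffel e k i j) e.target := by
  have h : ∀ i j l : Fin n, ContDiffOn ℝ ∞ (partialDeriv i (metricCoeff e j l)) e.target :=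
    fun i j l => ((contDiffOn_metricCoeff he j l).fderiv_of_isOpen e.open_target
      (by simp)).clm_apply contDiffOn_const
  exact contDiffOn_const.mul <| ContDiffOn.sum fun l _ => (contDiffOn_metricInv he k l).mul
    (((h i j l).add (h j i l)).sub (h l i j))

theorem contDiffOn_forceDown (he : e ∈ IsManifold.maximalAtlas (𝓡 n) ∞ M)
    (hF : ∀ k, ContDiffOn ℝ ∞ (fun z : Coord n × Coord n => forceUp e F k z.1 z.2)
      (phaseDomain e)) (i : Fin n) :
    ContDiffOn ℝ ∞ (fun z : Coord n × Coord n => forceDown e F i z.1 z.2) (phaseDomain e) :=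
  ContDiffOn.sum (s := Finset.univ) fun j _ => (contDiffOn_metricCoeff_phase he i j).mul (hF j)

theorem contDiffOn_forceForm (he : e ∈ IsManifold.maximalAtlas (𝓡 n) ∞ M)
    (hF : ∀ k, ContDiffOn ℝ ∞ (fun z : Coord n × Coord n => forceUp e F k z.1 z.2)
      (phaseDomain e)) :
    ContDiffOn ℝ ∞ (forceForm e F) (phaseDomain e) :=
  ContDiffOn.sum fun i _ => (contDiffOn_forceDown he hF i).smul contDiffOn_const

theorem contDiffOn_acceleration (he : e ∈ IsManifold.maximalAtlas (𝓡 n) ∞ M)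
    (hF : ∀ k, ContDiffOn ℝ ∞ (fun z : Coord n × Coord n => forceUp e F k z.1 z.2)
      (phaseDomain e)) :
    ContDiffOn ℝ ∞ (acceleration e F) (phaseDomain e) :=
  contDiffOn_euclidean.2 fun k => (hF k).sub <| ContDiffOn.sum fun i _ => ContDiffOn.sum
    fun j _ => (((contDiffOn_christoffel he k i j).comp contDiffOn_fst fun _ hz => hz.1).mul
      (contDiffOn_coord_snd i _)).mul (contDiffOn_coord_snd j _)

theorem hasFDerivAt_metricCoeff_fst (he : e ∈ IsManifold.maximalAtlas (𝓡 n) ∞ M)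
    {z : Coord n × Coord n} (hz : z.1 ∈ e.target) (i j : Fin n) :
    HasFDerivAt (fun z : Coord n × Coord n => metricCoeff e i j z.1)
      ((fderiv ℝ (metricCoeff e i j) z.1).comp (ContinuousLinearMap.fst ℝ _ _)) z :=
  (((contDiffOn_metricCoeff he i j).contDiffAt (e.open_target.mem_nhds hz)).differentiableAt
    (by simp)).hasFDerivAt.comp z hasFDerivAt_fst

theorem hasFDerivAt_coord_snd (i : Fin n) (z : Coord n × Coord n) :
    HasFDerivAt (fun z : Coord n × Coord n => z.2 i)
      ((EuclideanSpace.proj i : Coord n →L[ℝ] ℝ).comp (ContinuousLinearMap.snd ℝ _ _)) z :=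
  ((EuclideanSpace.proj i : Coord n →L[ℝ] ℝ).comp
    (ContinuousLinearMap.snd ℝ (Coord n) (Coord n))).hasFDerivAt

theorem fderiv_kinetic (he : e ∈ IsManifold.maximalAtlas (𝓡 n) ∞ M)
    {z : Coord n × Coord n} (hz : z.1 ∈ e.target) (u w : Coord n) :
    fderiv ℝ (kinetic e) z (u, w)
      = (1 / 2) * (∑ i, ∑ j, fderiv ℝ (metricCoeff e i j) z.1 u * z.2 i * z.2 j)
        + ∑ i, ∑ j, metricCoeff e i j z.1 * z.2 i * w j := by
  have h := (HasFDerivAt.fun_sum (u := Finset.univ) fun i _ => HasFDerivAt.fun_sum (u := Finset.univ)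
    fun j _ => ((hasFDerivAt_metricCoeff_fst he hz i j).mul (hasFDerivAt_coord_snd i z)).mul
      (hasFDerivAt_coord_snd j z)).const_mul (1 / 2)
  have h' : fderiv ℝ (kinetic e) z = _ := h.fderiv
  have hs := sum_sum_symm_swap (fun i j => metricCoeff_symm (e := e) i j z.1) w z.2
  have e1 : ∑ i, ∑ j, metricCoeff e i j z.1 * z.2 i * w j
      = (1 / 2) * (∑ i, ∑ j, metricCoeff e i j z.1 * z.2 i * w j)
        + (1 / 2) * ∑ i, ∑ j, metricCoeff e i j z.1 * w i * z.2 j := by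
    rw [hs]; ring
  rw [h', e1]
  simp only [← Finset.sum_add_distrib, ← mul_add]
  simp
  refine Finset.sum_congr rfl fun i _ => Finset.sum_congr rfl fun j _ => ?_
  ring

theorem fderiv_fderiv_kinetic (he : e ∈ IsManifold.maximalAtlas (𝓡 n) ∞ M)
    {z : Coord n × Coord n} (hz : z ∈ phaseDomain e) (w₁ w₂ u : Coord n) :
    fderiv ℝ (fderiv ℝ (kinetic e)) z (w₁, w₂) (0, u)
      = (∑ i, ∑ j, fderiv ℝ (metricCoeff e i j) z.1 w₁ * z.2 i * u j)
        + ∑ i, ∑ j, metricCoeff e i j z.1 * w₂ i * u j := by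
  have hd : DifferentiableAt ℝ (fderiv ℝ (kinetic e)) z :=
    (((contDiffOn_kinetic he).fderiv_of_isOpen isOpen_phaseDomain (m := ∞) (by simp)).contDiffAt
      (isOpen_phaseDomain.mem_nhds hz)).differentiableAt (by simp)
  have h1 : (fun z => fderiv ℝ (kinetic e) z (0, u)) =ᶠ[nhds z]
      fun z => ∑ i, ∑ j, metricCoeff e i j z.1 * z.2 i * u j := by
    filter_upwards [isOpen_phaseDomain.mem_nhds hz] with y hy
    rw [fderiv_kinetic he hy.1]
    simp
  have h2 : fderiv ℝ (fun z => fderiv ℝ (kinetic e) z (0, u)) z (w₁, w₂)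
      = fderiv ℝ (fderiv ℝ (kinetic e)) z (w₁, w₂) (0, u) := by
    rw [(hd.hasFDerivAt.clm_apply (hasFDerivAt_const _ z)).fderiv]; simp
  have h := (HasFDerivAt.fun_sum (u := Finset.univ) fun i _ => HasFDerivAt.fun_sum (u := Finset.univ)
    fun j _ => ((hasFDerivAt_metricCoeff_fst he hz.1 i j).mul (hasFDerivAt_coord_snd i z)).mul_const
      (u j))
  have h' : fderiv ℝ (fun z : Coord n × Coord n =>
    ∑ i, ∑ j, metricCoeff e i j z.1 * z.2 i * u j) z = _ := h.fderiv
  rw [← h2, h1.fderiv_eq, h']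
  simp only [← Finset.sum_add_distrib]
  simp
  refine Finset.sum_congr rfl fun i _ => Finset.sum_congr rfl fun j _ => ?_
  ring

/-- Lowering the index of the acceleration turns the Christoffel term into first derivatives of the
metric (`sum_christoffel_contract`). These cancel the metric derivatives in `D²K` except for those
forming `∂K/∂x`. -/
theorem lagrange_equation (he : e ∈ IsManifold.maximalAtlas (𝓡 n) ∞ M)
    {z : Coord n × Coord n} (hz : z ∈ phaseDomain e) (u : Coord n) :
    fderiv ℝ (fderiv ℝ (kinetic e)) z (spray (acceleration e F) z) (0, u)
      = fderiv ℝ (kinetic e) z (u, 0) + forceForm e F z u := by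
  rw [spray, fderiv_fderiv_kinetic he hz, fderiv_kinetic he hz.1, forceForm_apply]
  have h1 : ∑ i, ∑ j, metricCoeff e i j z.1 * acceleration e F z i * u j
      = ∑ i, forceDown e F i z.1 z.2 * u i
        - ∑ l, ∑ k, metricCoeff e l k z.1 * u l
          * (∑ i, ∑ j, christoffel e k i j z.1 * z.2 i * z.2 j) := by
    rw [sum_sum_symm_swap (fun i j => metricCoeff_symm i j z.1), ← Finset.sum_sub_distrib]
    refine Finset.sum_congr rfl fun l _ => ?_
    rw [forceDown, lower, Finset.sum_mul, ← Finset.sum_sub_distrib]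
    refine Finset.sum_congr rfl fun k _ => ?_
    simp only [acceleration]
    ring
  rw [h1, sum_christoffel_contract he hz.1]
  simp
  ring

/-- Lagrange's equation tested on the velocity itself: since `K` is quadratic in `v`, the
metric-derivative term on the left is twice the one on the right. -/
theorem energy_equation (he : e ∈ IsManifold.maximalAtlas (𝓡 n) ∞ M)
    {z : Coord n × Coord n} (hz : z ∈ phaseDomain e) :
    fderiv ℝ (kinetic e) z (spray (acceleration e F) z) = forceForm e F z z.2 := by
  have h := lagrange_equation (F := F) he hz z.2
  rw [spray, fderiv_fderiv_kinetic he hz, fderiv_kinetic he hz.1,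
    sum_sum_symm_swap (fun i j => metricCoeff_symm i j z.1)] at h
  rw [spray, fderiv_kinetic he hz.1]
  simp at h ⊢
  linarith

end Smooth

end CoordinateDynamics

/-! ### Contraction with the projector and the first equation -/

section Contraction

variable {n : ℕ} {M : Type*} [TopologicalSpace M] [ChartedSpace (Coord n) M]
  {e : OpenPartialHomeomorph M (Coord n)}
  [RiemannianBundle (fun p : M => TangentSpace (𝓡 n) p)]
  {F : ∀ p : M, TangentSpace (𝓡 n) p → TangentSpace (𝓡 n) p}

theorem speed_pos (he : e ∈ IsManifold.maximalAtlas (𝓡 n) ∞ M) {x v : Coord n}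
    (hx : x ∈ e.target) (hv : v ≠ 0) : 0 < speed e x v :=
  Real.sqrt_pos.2 (sum_metricCoeff_pos he hx hv)

theorem speed_sq (he : e ∈ IsManifold.maximalAtlas (𝓡 n) ∞ M) {x v : Coord n}
    (hx : x ∈ e.target) (hv : v ≠ 0) :
    speed e x v ^ 2 = ∑ i, ∑ j, metricCoeff e i j x * v i * v j :=
  Real.sq_sqrt (sum_metricCoeff_pos he hx hv).le

/-- The vector `P^i_k`, `k` fixed. -/
def projectorVec (e : OpenPartialHomeomorph M (Coord n)) (k : Fin n) (x v : Coord n) : Coord n :=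
  WithLp.toLp 2 fun i => projector e i k x v

variable [IsManifold (𝓡 n) ∞ M]
  [IsContMDiffRiemannianBundle (𝓡 n) ∞ (Coord n) (fun p : M => TangentSpace (𝓡 n) p)]

theorem fderiv_kinetic_snd (he : e ∈ IsManifold.maximalAtlas (𝓡 n) ∞ M)
    {z : Coord n × Coord n} (hz : z.1 ∈ e.target) (u : Coord n) :
    fderiv ℝ (kinetic e) z (0, u) = ∑ i, ∑ j, metricCoeff e i j z.1 * z.2 i * u j := by
  rw [fderiv_kinetic he hz]; simp

/-- The columns of the projector are orthogonal to `v`, so they are admissible test vectors `u`, and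
contracting with them yields the stated equations. -/
theorem fderiv_kinetic_projectorVec (he : e ∈ IsManifold.maximalAtlas (𝓡 n) ∞ M)
    {x v : Coord n} (hx : x ∈ e.target) (hv : v ≠ 0) (k : Fin n) :
    fderiv ℝ (kinetic e) (x, v) (0, projectorVec e k x v) = 0 := by
  have hs := (speed_pos he hx hv).ne'
  have h2 := speed_sq he hx hv
  set s := speed e x v with hsdef
  set c := ∑ j, metricCoeff e k j x * v j with hc
  have hP : ∀ i, projectorVec e k x v i = (if i = k then 1 else 0) - c / s ^ 2 * v i := by
    intro i
    have : ∑ j, metricCoeff e k j x * (v j / s) = c / s := by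
      rw [hc, Finset.sum_div]; exact Finset.sum_congr rfl fun j _ => by ring
    simp only [projectorVec, projector, lower, unitUp, ← hsdef, this]
    field_simp
  rw [fderiv_kinetic_snd he hx]
  simp only [hP, mul_sub, Finset.sum_sub_distrib]
  have e1 : ∑ i, ∑ j, metricCoeff e i j x * v i * (if j = k then (1 : ℝ) else 0) = c := by
    simp only [mul_ite, mul_one, mul_zero, Finset.sum_ite_eq', Finset.mem_univ, if_true, hc]
    exact Finset.sum_congr rfl fun i _ => by rw [metricCoeff_symm]
  have e2 : ∑ i, ∑ j, metricCoeff e i j x * v i * (c / s ^ 2 * v j) = c := by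
    have : ∑ i, ∑ j, metricCoeff e i j x * v i * (c / s ^ 2 * v j)
        = c / s ^ 2 * ∑ i, ∑ j, metricCoeff e i j x * v i * v j := by
      simp only [Finset.mul_sum]
      exact Finset.sum_congr rfl fun i _ => Finset.sum_congr rfl fun j _ => by ring
    rw [this, ← h2]
    field_simp
  rw [e1, e2, sub_self]

theorem differentiableAt_forceDown (he : e ∈ IsManifold.maximalAtlas (𝓡 n) ∞ M)
    (hF : ∀ k, ContDiffOn ℝ ∞ (fun z : Coord n × Coord n => forceUp e F k z.1 z.2)
      (phaseDomain e)) {z : Coord n × Coord n} (hz : z ∈ phaseDomain e) (i : Fin n) :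
    DifferentiableAt ℝ (fun z : Coord n × Coord n => forceDown e F i z.1 z.2) z :=
  ((contDiffOn_forceDown he hF i).contDiffAt (isOpen_phaseDomain.mem_nhds hz)).differentiableAt
    (by simp)

/-- The differential of the covariant component `F_i` of the force field on phase space. -/
def forceDeriv (e : OpenPartialHomeomorph M (Coord n))
    (F : ∀ p : M, TangentSpace (𝓡 n) p → TangentSpace (𝓡 n) p) (i : Fin n)
    (z : Coord n × Coord n) : Coord n × Coord n →L[ℝ] ℝ :=
  fderiv ℝ (fun z : Coord n × Coord n => forceDown e F i z.1 z.2) z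

theorem fderiv_forceForm (he : e ∈ IsManifold.maximalAtlas (𝓡 n) ∞ M)
    (hF : ∀ k, ContDiffOn ℝ ∞ (fun z : Coord n × Coord n => forceUp e F k z.1 z.2)
      (phaseDomain e)) {z : Coord n × Coord n} (hz : z ∈ phaseDomain e) (w : Coord n × Coord n)
    (u : Coord n) :
    fderiv ℝ (forceForm e F) z w u = ∑ i, forceDeriv e F i z w * u i := by
  have h := HasFDerivAt.fun_sum (u := Finset.univ) fun i _ =>
    ((differentiableAt_forceDown he hF hz i).hasFDerivAt.smul_const
      (EuclideanSpace.proj i : Coord n →L[ℝ] ℝ))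
  have h' : fderiv ℝ (forceForm e F) z = _ := h.fderiv
  rw [h']
  simp [forceDeriv]

theorem fderiv_power (he : e ∈ IsManifold.maximalAtlas (𝓡 n) ∞ M)
    (hF : ∀ k, ContDiffOn ℝ ∞ (fun z : Coord n × Coord n => forceUp e F k z.1 z.2)
      (phaseDomain e)) {z : Coord n × Coord n} (hz : z ∈ phaseDomain e) (w : Coord n × Coord n) :
    fderiv ℝ (fun z => forceForm e F z z.2) z w
      = ∑ i, forceDeriv e F i z w * z.2 i + forceForm e F z w.2 := by
  have hd : DifferentiableAt ℝ (forceForm e F) z :=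
    ((contDiffOn_forceForm he hF).contDiffAt (isOpen_phaseDomain.mem_nhds hz)).differentiableAt
      (by simp)
  rw [(hd.hasFDerivAt.clm_apply hasFDerivAt_snd).fderiv]
  simp [fderiv_forceForm he hF hz, add_comm]

theorem velGrad_forceDown (he : e ∈ IsManifold.maximalAtlas (𝓡 n) ∞ M)
    (hF : ∀ k, ContDiffOn ℝ ∞ (fun z : Coord n × Coord n => forceUp e F k z.1 z.2)
      (phaseDomain e)) {x v : Coord n} (hz : (x, v) ∈ phaseDomain e) (i a : Fin n) :
    velGrad a (forceDown e F i) x v = forceDeriv e F i (x, v) (0, basisVec a) := by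
  have h := (differentiableAt_forceDown he hF hz i).hasFDerivAt.comp v
    (hasFDerivAt_prodMk_right x v)
  have h' : fderiv ℝ (fun w => forceDown e F i x w) v = _ := h.fderiv
  rw [velGrad, partialDeriv, h']
  rfl

theorem partialDeriv_forceDown (he : e ∈ IsManifold.maximalAtlas (𝓡 n) ∞ M)
    (hF : ∀ k, ContDiffOn ℝ ∞ (fun z : Coord n × Coord n => forceUp e F k z.1 z.2)
      (phaseDomain e)) {x v : Coord n} (hz : (x, v) ∈ phaseDomain e) (i a : Fin n) :
    partialDeriv a (fun y => forceDown e F i y v) x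
      = forceDeriv e F i (x, v) (basisVec a, 0) := by
  have h := (differentiableAt_forceDown he hF hz i).hasFDerivAt.comp
    (f := fun y => (y, v)) x (hasFDerivAt_prodMk_left x v)
  have h' : fderiv ℝ (fun y => forceDown e F i y v) x = _ := h.fderiv
  rw [partialDeriv, h']
  rfl

/-- Here `N^j F_j` is the power divided by `√(2K)`, and the speed is stationary in the velocity
direction `u`. The left side is thus `powerForm` divided by the speed. -/
theorem first_equation_of_powerForm (he : e ∈ IsManifold.maximalAtlas (𝓡 n) ∞ M)
    (hF : ∀ k, ContDiffOn ℝ ∞ (fun z : Coord n × Coord n => forceUp e F k z.1 z.2)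
      (phaseDomain e)) {x v : Coord n} (hx : x ∈ e.target) (hv : v ≠ 0) {u : Coord n}
    (hu : fderiv ℝ (kinetic e) (x, v) (0, u) = 0) (h : powerForm (forceForm e F) (x, v) u = 0) :
    ∑ i, ((speed e x v)⁻¹ * forceDown e F i x v
        + velGrad i (fun y w => ∑ j, unitUp e j y w * forceDown e F j y w) x v) * u i = 0 := by
  have hz : (x, v) ∈ phaseDomain e := ⟨hx, hv⟩
  have hs := speed_pos he hx hv
  have hev : (fun w => ∑ j, unitUp e j x w * forceDown e F j x w)
      = fun w => (Real.sqrt (2 * kinetic e (x, w)))⁻¹ * forceForm e F (x, w) w := by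
    funext w
    rw [forceForm_apply, Finset.mul_sum]
    refine Finset.sum_congr rfl fun j _ => ?_
    have : speed e x w = Real.sqrt (2 * kinetic e (x, w)) := by
      rw [speed, kinetic]; congr 1; ring
    rw [unitUp, this]
    ring
  have hsp : Real.sqrt (2 * kinetic e (x, v)) = speed e x v := by
    rw [speed, kinetic]; congr 1; ring
  have hK : HasFDerivAt (fun w => kinetic e (x, w)) _ v :=
    (((contDiffOn_kinetic he).contDiffAt (isOpen_phaseDomain.mem_nhds hz)).differentiableAt
      (by simp)).hasFDerivAt.comp v (hasFDerivAt_prodMk_right x v)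
  have hW : HasFDerivAt (fun w => forceForm e F (x, w) w) _ v :=
    (((contDiffOn_power (contDiffOn_forceForm he hF)).contDiffAt
      (isOpen_phaseDomain.mem_nhds hz)).differentiableAt
      (by simp)).hasFDerivAt.comp v (hasFDerivAt_prodMk_right x v)
  have hKpos : 2 * kinetic e (x, v) ≠ 0 := fun h => by
    rw [h, Real.sqrt_zero] at hsp; exact hs.ne hsp
  have hsqrt := ((hK.const_mul 2).sqrt hKpos)
  have hinv := (hasDerivAt_inv (by rw [hsp]; exact hs.ne')).comp_hasFDerivAt v hsqrt
  have hfin : fderiv ℝ (fun w => (Real.sqrt (2 * kinetic e (x, w)))⁻¹ * forceForm e F (x, w) w) v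
      = _ := (hinv.mul hW).fderiv
  have key : ∑ i, velGrad i (fun y w => ∑ j, unitUp e j y w * forceDown e F j y w) x v * u i
      = (speed e x v)⁻¹ * fderiv ℝ (fun z => forceForm e F z z.2) (x, v) (0, u) := by
    have h1 : ∑ i, velGrad i (fun y w => ∑ j, unitUp e j y w * forceDown e F j y w) x v * u i
        = fderiv ℝ (fun w => ∑ j, unitUp e j x w * forceDown e F j x w) v u := by
      rw [← sum_mul_apply_basisVec]
      exact Finset.sum_congr rfl fun i _ => by rw [velGrad, partialDeriv, mul_comm]
    rw [h1, hev, hfin]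
    simp only [Function.comp, hsp]
    simp [hu]
  simp only [add_mul, Finset.sum_add_distrib, key]
  have h2 : ∑ i, (speed e x v)⁻¹ * forceDown e F i x v * u i
      = (speed e x v)⁻¹ * forceForm e F (x, v) u := by
    rw [forceForm_apply, Finset.mul_sum]
    exact Finset.sum_congr rfl fun i _ => by ring
  rw [h2, ← mul_add, add_comm, ← powerForm, h, mul_zero]

end Contraction

/-! ### Covariant form of the third order condition -/

section SecondEquation

variable {n : ℕ} {M : Type*} [TopologicalSpace M] [ChartedSpace (Coord n) M]
  {e : OpenPartialHomeomorph M (Coord n)}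
  [RiemannianBundle (fun p : M => TangentSpace (𝓡 n) p)]
  {F : ∀ p : M, TangentSpace (𝓡 n) p → TangentSpace (𝓡 n) p}

/-- The vector `∑ Γ^k_{ij} p^i q^j`. -/
def christoffelVec (e : OpenPartialHomeomorph M (Coord n)) (x p q : Coord n) : Coord n :=
  WithLp.toLp 2 fun k => ∑ i, ∑ j, christoffel e k i j x * p i * q j

theorem christoffelVec_comm (x p q : Coord n) :
    christoffelVec e x p q = christoffelVec e x q p := by
  ext k
  exact sum_sum_symm_swap (fun i j => christoffel_symm k i j x) p q

theorem forceDeriv_snd (j : Fin n) (z : Coord n × Coord n) (w : Coord n) :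
    forceDeriv e F j z (0, w) = ∑ a, w a * forceDeriv e F j z (0, basisVec a) :=
  (sum_mul_apply_basisVec ((forceDeriv e F j z).comp (ContinuousLinearMap.inr ℝ _ _)) w).symm

theorem forceDeriv_fst (j : Fin n) (z : Coord n × Coord n) (w : Coord n) :
    forceDeriv e F j z (w, 0) = ∑ a, w a * forceDeriv e F j z (basisVec a, 0) :=
  (sum_mul_apply_basisVec ((forceDeriv e F j z).comp (ContinuousLinearMap.inl ℝ _ _)) w).symm

variable [IsManifold (𝓡 n) ∞ M]
  [IsContMDiffRiemannianBundle (𝓡 n) ∞ (Coord n) (fun p : M => TangentSpace (𝓡 n) p)]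

/-- The spatial gradient differentiates along the horizontal lift `(p, -Γ(p, v))` of `p` and
corrects for the covector index by `α(Γ(p, q))`. -/
theorem sum_spatialGrad (he : e ∈ IsManifold.maximalAtlas (𝓡 n) ∞ M)
    (hF : ∀ k, ContDiffOn ℝ ∞ (fun z : Coord n × Coord n => forceUp e F k z.1 z.2)
      (phaseDomain e)) {x v : Coord n} (hz : (x, v) ∈ phaseDomain e) (p q : Coord n) :
    ∑ i, ∑ j, spatialGrad e i (forceDown e F) j x v * p i * q j
      = ∑ j, forceDeriv e F j (x, v) (p, -christoffelVec e x p v) * q j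
        - forceForm e F (x, v) (christoffelVec e x p q) := by
  have h1 : ∀ j, forceDeriv e F j (x, v) (p, -christoffelVec e x p v)
      = ∑ i, p i * forceDeriv e F j (x, v) (basisVec i, 0)
        - ∑ i, ∑ a, ∑ b, christoffel e a i b x * v b * forceDeriv e F j (x, v) (0, basisVec a)
          * p i := fun j => by
    have : (p, -christoffelVec e x p v) = ((p, 0) : Coord n × Coord n)
      - (0, christoffelVec e x p v) := by simp
    rw [this, map_sub, forceDeriv_snd, forceDeriv_fst]
    congr 1
    rw [Finset.sum_comm]
    refine Finset.sum_congr rfl fun a _ => ?_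
    simp only [christoffelVec, Finset.sum_mul]
    exact Finset.sum_congr rfl fun i _ => Finset.sum_congr rfl fun b _ => by ring
  have h2 : forceForm e F (x, v) (christoffelVec e x p q)
      = ∑ i, ∑ j, ∑ a, christoffel e a i j x * forceDown e F a x v * p i * q j := by
    rw [forceForm_apply]
    simp only [christoffelVec, Finset.mul_sum]
    rw [Finset.sum_comm]
    refine Finset.sum_congr rfl fun i _ => ?_
    rw [Finset.sum_comm]
    exact Finset.sum_congr rfl fun j _ => Finset.sum_congr rfl fun a _ => by ring
  rw [h2]
  conv_rhs => enter [1, 2, j]; rw [h1 j, ← Finset.sum_sub_distrib, Finset.sum_mul]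
  conv_rhs => enter [1]; rw [Finset.sum_comm]
  rw [← Finset.sum_sub_distrib]
  refine Finset.sum_congr rfl fun i _ => ?_
  rw [← Finset.sum_sub_distrib]
  refine Finset.sum_congr rfl fun j _ => ?_
  simp only [spatialGrad, velGrad_forceDown he hF hz, partialDeriv_forceDown he hF hz]
  simp only [sub_mul, Finset.sum_mul]
  ring

/-- Metric compatibility of the connection: the kinetic energy is constant along the horizontal lift
`(u, -Γ(u, v))`. -/
theorem fderiv_kinetic_christoffelVec (he : e ∈ IsManifold.maximalAtlas (𝓡 n) ∞ M)
    {x v : Coord n} (hx : x ∈ e.target) (u : Coord n) :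
    fderiv ℝ (kinetic e) (x, v) (0, christoffelVec e x u v)
      = fderiv ℝ (kinetic e) (x, v) (u, 0) := by
  rw [fderiv_kinetic_snd he hx, fderiv_kinetic he hx]
  simp only [christoffelVec]
  rw [sum_christoffel_contract he hx,
    sum_sum_symm_swap (fun i j => by rw [fderiv_metricCoeff_symm]) u v]
  simp

/-- Passing from coordinate to horizontal derivatives creates terms `α(Γ(u, v))` of opposite signs,
which cancel, and a term that absorbs `l · ∂K/∂x`. What remains is the value of `l`, which supplies
the terms quadratic in the force. -/
theorem second_equation_of_third_order (he : e ∈ IsManifold.maximalAtlas (𝓡 n) ∞ M)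
    (hF : ∀ k, ContDiffOn ℝ ∞ (fun z : Coord n × Coord n => forceUp e F k z.1 z.2)
      (phaseDomain e)) {x v : Coord n} (hx : x ∈ e.target) (hv : v ≠ 0) {u : Coord n} {l : ℝ}
    (hprop : ∀ w, powerForm (forceForm e F) (x, v) w = l * fderiv ℝ (kinetic e) (x, v) (0, w))
    (hu : fderiv ℝ (fun z => forceForm e F z z.2) (x, v) (u, 0)
      + fderiv ℝ (forceForm e F) (x, v) (spray (acceleration e F) (x, v)) u
      - l * (forceForm e F (x, v) u + fderiv ℝ (kinetic e) (x, v) (u, 0)) = 0) :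
    ∑ i, ∑ j, (spatialGrad e i (forceDown e F) j x v + spatialGrad e j (forceDown e F) i x v
          - 2 * (speed e x v ^ 2)⁻¹ * forceDown e F i x v * forceDown e F j x v)
        * unitUp e j x v * u i
      + ∑ i, ∑ j, (forceUp e F j x v * velGrad j (forceDown e F i) x v / speed e x v
          - ∑ r, unitUp e r x v * unitUp e j x v * velGrad j (forceDown e F r) x v / speed e x v
              * forceDown e F i x v) * u i = 0 := by
  have hz : (x, v) ∈ phaseDomain e := ⟨hx, hv⟩
  have hs := speed_pos he hx hv
  have hs2 := speed_sq he hx hv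
  set s := speed e x v with hsdef
  set α := forceForm e F (x, v) with hα
  set R := ∑ r, forceDeriv e F r (x, v) (0, v) * v r with hR
  -- The multiplier is found by testing proportionality on `w = v`, where `∂K/∂v · v` is the squared
  -- speed.
  have hlam : l * s ^ 2 = R + 2 * α v := by
    have h := hprop v
    rw [fderiv_kinetic_snd he hx, ← hs2, powerForm, fderiv_power he hF hz] at h
    simp only at h
    rw [← h]; ring
  -- the three groups of terms
  have hA1 : ∑ i, ∑ j, spatialGrad e i (forceDown e F) j x v * u i * v j
      = fderiv ℝ (fun z => forceForm e F z z.2) (x, v) (u, 0)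
        - l * fderiv ℝ (kinetic e) (x, v) (u, 0) + α (christoffelVec e x u v) := by
    rw [sum_spatialGrad he hF hz]
    have h1 := hprop (christoffelVec e x u v)
    rw [fderiv_kinetic_christoffelVec he hx, powerForm] at h1
    have h2 := fderiv_power he hF hz (u, -christoffelVec e x u v)
    have h3 : (u, -christoffelVec e x u v) = ((u, 0) : Coord n × Coord n)
      - (0, christoffelVec e x u v) := by simp
    rw [h3, map_sub] at h2
    rw [h3]
    simp only [Prod.mk_sub_mk, sub_zero, zero_sub, map_neg] at h2 ⊢
    linarith
  -- The field of the motion is the horizontal lift of `v` plus the vertical vector `F`.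
  have hA23 : (∑ i, ∑ j, spatialGrad e j (forceDown e F) i x v * v j * u i)
      + ∑ i, ∑ j, forceUp e F j x v * velGrad j (forceDown e F i) x v * u i
      = fderiv ℝ (forceForm e F) (x, v) (spray (acceleration e F) (x, v)) u
        - α (christoffelVec e x u v) := by
    rw [Finset.sum_comm, sum_spatialGrad he hF hz, fderiv_forceForm he hF hz,
      christoffelVec_comm x v u]
    have : ∀ i, ∑ j, forceUp e F j x v * velGrad j (forceDown e F i) x v * u i
        = forceDeriv e F i (x, v) (0, WithLp.toLp 2 fun j => forceUp e F j x v) * u i := by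
      intro i
      rw [forceDeriv_snd, Finset.sum_mul]
      exact Finset.sum_congr rfl fun j _ => by rw [velGrad_forceDown he hF hz]
    rw [Finset.sum_congr rfl fun i _ => this i, sub_add_eq_add_sub, ← Finset.sum_add_distrib]
    congr 1
    refine Finset.sum_congr rfl fun i _ => ?_
    rw [← add_mul, ← map_add]
    congr 2
    simp only [spray, Prod.mk_add_mk, add_zero]
    congr 1
    ext k
    simp [acceleration, christoffelVec]
    ring
  have hA4 : ∑ i, ∑ j, forceDown e F i x v * forceDown e F j x v * v j * u i = α u * α v := by
    rw [hα, forceForm_apply, forceForm_apply, Finset.sum_mul_sum]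
    exact Finset.sum_congr rfl fun i _ => Finset.sum_congr rfl fun j _ => by ring
  have hA5 : ∑ i, ∑ j, ∑ r, v r * v j * velGrad j (forceDown e F r) x v * forceDown e F i x v * u i
      = R * α u := by
    rw [hα, forceForm_apply, Finset.mul_sum]
    refine Finset.sum_congr rfl fun i _ => ?_
    rw [Finset.sum_comm, hR, Finset.sum_mul]
    refine Finset.sum_congr rfl fun r _ => ?_
    rw [forceDeriv_snd, Finset.sum_mul, Finset.sum_mul]
    exact Finset.sum_congr rfl fun j _ => by rw [velGrad_forceDown he hF hz]; ring
  have hB1 : ∑ i, ∑ j, (spatialGrad e i (forceDown e F) j x v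
        + spatialGrad e j (forceDown e F) i x v
          - 2 * (s ^ 2)⁻¹ * forceDown e F i x v * forceDown e F j x v) * unitUp e j x v * u i
      = s⁻¹ * ((∑ i, ∑ j, spatialGrad e i (forceDown e F) j x v * u i * v j)
        + (∑ i, ∑ j, spatialGrad e j (forceDown e F) i x v * v j * u i)
        - 2 * (s ^ 2)⁻¹
          * ∑ i, ∑ j, forceDown e F i x v * forceDown e F j x v * v j * u i) := by
    simp only [Finset.mul_sum, ← Finset.sum_add_distrib, ← Finset.sum_sub_distrib]
    refine Finset.sum_congr rfl fun i _ => Finset.sum_congr rfl fun j _ => ?_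
    rw [unitUp, ← hsdef]
    ring
  have hB2 : ∑ i, ∑ j, (forceUp e F j x v * velGrad j (forceDown e F i) x v / s
          - ∑ r, unitUp e r x v * unitUp e j x v * velGrad j (forceDown e F r) x v / s
              * forceDown e F i x v) * u i
      = s⁻¹ * ((∑ i, ∑ j, forceUp e F j x v * velGrad j (forceDown e F i) x v * u i)
        - (s ^ 2)⁻¹ * ∑ i, ∑ j, ∑ r,
          v r * v j * velGrad j (forceDown e F r) x v * forceDown e F i x v * u i) := by
    simp only [Finset.mul_sum, ← Finset.sum_sub_distrib]
    refine Finset.sum_congr rfl fun i _ => Finset.sum_congr rfl fun j _ => ?_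
    rw [sub_mul, mul_sub]
    congr 1
    · ring
    · rw [Finset.sum_mul, Finset.mul_sum]
      refine Finset.sum_congr rfl fun r _ => ?_
      rw [unitUp, unitUp, ← hsdef]
      ring
  rw [hB1, hB2, hA4, hA5, hA1, ← mul_add]
  have hl : l = (s ^ 2)⁻¹ * (R + 2 * α v) := by
    rw [← hlam]; field_simp
  have hfinal : fderiv ℝ (fun z => forceForm e F z z.2) (x, v) (u, 0)
      + fderiv ℝ (forceForm e F) (x, v) (spray (acceleration e F) (x, v)) u
      - l * fderiv ℝ (kinetic e) (x, v) (u, 0) - (s ^ 2)⁻¹ * (R + 2 * α v) * α u = 0 := by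
    rw [← hl]; linarith
  refine mul_eq_zero_of_right _ ?_
  linarith

end SecondEquation

/-! ### Variation of a trajectory by turning its initial velocity -/

section Variation

/-- The great circle through two orthonormal vectors is a smooth curve in the unit sphere. -/
theorem exists_greatCircle {E : Type*} [NormedAddCommGroup E] [InnerProductSpace ℝ E] {k : ℕ}
    [Fact (Module.finrank ℝ E = k + 1)] {v u : E} (hv : ‖v‖ = 1) (hu : ‖u‖ = 1)
    (huv : inner ℝ v u = 0) :
    ∃ q : ℝ → sphere (0 : E) 1, ContMDiff 𝓘(ℝ, ℝ) (𝓡 k) ∞ q ∧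
      ∀ s, (q s : E) = Real.cos s • v + Real.sin s • u := by
  have hmem : ∀ s : ℝ, Real.cos s • v + Real.sin s • u ∈ sphere (0 : E) 1 := fun s => by
    have h : ‖Real.cos s • v + Real.sin s • u‖ ^ 2 = 1 := by
      rw [norm_add_sq_real, norm_smul, norm_smul, real_inner_smul_left, real_inner_smul_right,
        huv, hv, hu]
      simp
    rw [mem_sphere_zero_iff_norm]
    exact (pow_eq_one_iff_of_nonneg (norm_nonneg _) two_ne_zero).1 h
  have hsm : ContMDiff 𝓘(ℝ, ℝ) 𝓘(ℝ, E) ∞ fun s : ℝ => Real.cos s • v + Real.sin s • u :=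
    ((Real.contDiff_cos.smul contDiff_const).add
      (Real.contDiff_sin.smul contDiff_const)).contMDiff
  exact ⟨_, hsm.codRestrict_sphere hmem, fun s => rfl⟩

/-- The derivative with respect to the parameter of a one-parameter family of integral curves of
a vector field solves the linearized equation. -/
theorem hasDerivAt_fderiv_integralCurves {G : Type*} [NormedAddCommGroup G] [NormedSpace ℝ G]
    {Z : ℝ × ℝ → G} {S : G → G} {Ω : Set (ℝ × ℝ)} (hΩ : IsOpen Ω) (hZ : ContDiffOn ℝ ∞ Z Ω)
    (hS : ∀ y ∈ Ω, DifferentiableAt ℝ S (Z y))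
    (hint : ∀ y ∈ Ω, fderiv ℝ Z y (0, 1) = S (Z y)) {s t : ℝ} (hst : (s, t) ∈ Ω) :
    HasDerivAt (fun t => Z (s, t)) (S (Z (s, t))) t ∧
      HasDerivAt (fun t => fderiv ℝ Z (s, t) (1, 0))
        (fderiv ℝ S (Z (s, t)) (fderiv ℝ Z (s, t) (1, 0))) t := by
  have hline : HasDerivAt (fun t : ℝ => (s, t)) ((0 : ℝ), (1 : ℝ)) t :=
    (hasDerivAt_const t s).prodMk (hasDerivAt_id t)
  have hZc := hZ.contDiffAt (hΩ.mem_nhds hst)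
  have hZd : DifferentiableAt ℝ Z (s, t) := hZc.differentiableAt (by simp)
  have hdZ : DifferentiableAt ℝ (fderiv ℝ Z) (s, t) :=
    ((hZ.fderiv_of_isOpen hΩ (m := ∞) (by simp)).contDiffAt (hΩ.mem_nhds hst)).differentiableAt
      (by simp)
  refine ⟨?_, ?_⟩
  · have h := hZd.hasFDerivAt.comp_hasDerivAt t hline
    rwa [hint _ hst] at h
  · have h := (hdZ.hasFDerivAt.comp_hasDerivAt t hline).clm_apply
      (hasDerivAt_const t ((1 : ℝ), (0 : ℝ)))
    -- Mixed partials commute, so the `t`-derivative of `∂Z/∂s` is the `s`-derivative of `S(Z)`.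
    have hsymm : IsSymmSndFDerivAt ℝ Z (s, t) :=
      hZc.isSymmSndFDerivAt (by simpa using two_le_infty)
    have hev : (fun y => fderiv ℝ Z y (0, 1)) =ᶠ[nhds (s, t)] fun y => S (Z y) := by
      filter_upwards [hΩ.mem_nhds hst] with y hy using hint y hy
    have h1 : fderiv ℝ (fun y => fderiv ℝ Z y (0, 1)) (s, t) (1, 0)
        = fderiv ℝ (fderiv ℝ Z) (s, t) (1, 0) (0, 1) := by
      rw [(hdZ.hasFDerivAt.clm_apply (hasFDerivAt_const _ _)).fderiv]; simp
    have h2 := ((hS _ hst).hasFDerivAt.comp (s, t) hZd.hasFDerivAt).fderiv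
    have h3 : fderiv ℝ (fun y => S (Z y)) (s, t) = _ := h2
    rw [hev.fderiv_eq, h3] at h1
    rw [hsymm.eq, ← h1] at h
    simpa using h

variable {m : ℕ} {M : Type*} [TopologicalSpace M] [ChartedSpace (Coord (m + 1)) M]
  {F : ∀ p : M, TangentSpace (𝓡 (m + 1)) p → TangentSpace (𝓡 (m + 1)) p}
  {e : OpenPartialHomeomorph M (Coord (m + 1))}

/-- Velocities in a chart. -/
theorem hasDerivAt_chart_comp (he : e ∈ IsManifold.maximalAtlas (𝓡 (m + 1)) ∞ M) {γ : ℝ → M}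
    {t : ℝ} (hγ : MDifferentiableAt 𝓘(ℝ, ℝ) (𝓡 (m + 1)) γ t) (ht : γ t ∈ e.source) :
    HasDerivAt (fun s => e (γ s)) (coordOfVec e (γ t) (velocity γ t).2) t := by
  have h := ((chart_mdifferentiable he).mdifferentiableAt ht).hasMFDerivAt.comp t hγ.hasMFDerivAt
  let L : ℝ →L[ℝ] Coord (m + 1) := (mfderiv (𝓡 (m + 1)) (𝓡 (m + 1)) e (γ t)).comp
    (mfderiv 𝓘(ℝ, ℝ) (𝓡 (m + 1)) γ t)
  have h2 : HasFDerivAt (fun s => e (γ s)) L t := hasMFDerivAt_iff_hasFDerivAt.1 h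
  exact h2.hasDerivAt

variable [RiemannianBundle (fun p : M => TangentSpace (𝓡 (m + 1)) p)]

theorem velocity_blowUp_zero {p₀ : M} {ν₀ ε : ℝ} {f : UnitSphere (m := m) p₀ → ℝ → M}
    (hf : IsBlowUp F p₀ ν₀ ε f) (q : UnitSphere (m := m) p₀) :
    f q 0 = p₀ ∧ coordOfVec e (f q 0) (velocity (f q) 0).2
      = ν₀ • coordOfVec e p₀ (q : TangentSpace (𝓡 (m + 1)) p₀) := by
  have h := hf.initial q
  refine ⟨congrArg TotalSpace.proj h, ?_⟩
  have h2 := congrArg (fun w : TangentBundle (𝓡 (m + 1)) M => coordOfVec e w.proj w.snd) h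
  refine h2.trans ?_
  exact map_smul (mfderiv (𝓡 (m + 1)) (𝓡 (m + 1)) e p₀) ν₀ _

variable [IsManifold (𝓡 (m + 1)) ∞ M]
  [IsContMDiffRiemannianBundle (𝓡 (m + 1)) ∞ (Coord (m + 1))
    (fun p : M => TangentSpace (𝓡 (m + 1)) p)]

/-- Restricting the blow-up to the great circle through `v` and `u` gives a one-parameter family of
trajectories. In the chart, `z` is the phase curve of its member starting along `v`, and `T` is the
parameter derivative there. -/
theorem exists_variation (he : e ∈ IsManifold.maximalAtlas (𝓡 (m + 1)) ∞ M)
    (hF : ∀ k, ContDiffOn ℝ ∞ (fun z : Coord (m + 1) × Coord (m + 1) => forceUp e F k z.1 z.2)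
      (phaseDomain e))
    {p₀ : M} {ν₀ ε : ℝ} {f : UnitSphere (m := m) p₀ → ℝ → M} (hν : 0 < ν₀) (hε : 0 < ε)
    (hf : IsBlowUp F p₀ ν₀ ε f) (hn : IsNormal p₀ ε f) (hp : p₀ ∈ e.source)
    {v u : TangentSpace (𝓡 (m + 1)) p₀} (hv : ‖v‖ = 1) (hu : ‖u‖ = 1) (huv : inner ℝ v u = 0) :
    ∃ δ > 0, ∃ z T : ℝ → Coord (m + 1) × Coord (m + 1),
      (∀ t ∈ Ioo (-δ) δ, z t ∈ phaseDomain e) ∧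
      (∀ t ∈ Ioo (-δ) δ, HasDerivAt z (spray (acceleration e F) (z t)) t) ∧
      (∀ t ∈ Ioo (-δ) δ,
        HasDerivAt T (fderiv ℝ (spray (acceleration e F)) (z t) (T t)) t) ∧
      (∀ t ∈ Ioo 0 δ, fderiv ℝ (kinetic e) (z t) (0, (T t).1) = 0) ∧
      z 0 = (e p₀, ν₀ • coordOfVec e p₀ v) ∧ T 0 = (0, ν₀ • coordOfVec e p₀ u) := by
  obtain ⟨q, hq, hqs⟩ := exists_greatCircle (k := m) hv hu huv
  set J : Set ℝ := Ioo (-ε) ε with hJ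
  have hJo : IsOpen J := isOpen_Ioo
  have h0J : (0 : ℝ) ∈ J := ⟨by linarith, hε⟩
  -- the family in `M`
  set Φ : ℝ × ℝ → M := fun y => f (q y.1) y.2 with hΦdef
  have hΦ : ContMDiffOn 𝓘(ℝ, ℝ × ℝ) (𝓡 (m + 1)) ∞ Φ (univ ×ˢ J) := by
    have h1 : ContMDiff 𝓘(ℝ, ℝ × ℝ) ((𝓡 m).prod 𝓘(ℝ, ℝ)) ∞
        (fun y : ℝ × ℝ => (q y.1, y.2)) :=
      (hq.comp contDiff_fst.contMDiff).prodMk contDiff_snd.contMDiff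
    exact hf.smooth.comp h1.contMDiffOn fun y hy => ⟨trivial, hy.2⟩
  set Ω₀ : Set (ℝ × ℝ) := univ ×ˢ J ∩ Φ ⁻¹' e.source with hΩ₀
  have hΩ₀o : IsOpen Ω₀ :=
    hΦ.continuousOn.isOpen_inter_preimage (isOpen_univ.prod hJo) e.open_source
  set X : ℝ × ℝ → Coord (m + 1) := fun y => e (Φ y) with hXdef
  have hX : ContDiffOn ℝ ∞ X Ω₀ := contMDiffOn_iff_contDiffOn.1 <|
    (contMDiffOn_of_mem_maximalAtlas he).comp (hΦ.mono inter_subset_left) fun y hy => hy.2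
  have hXd : ∀ y ∈ Ω₀, DifferentiableAt ℝ X y := fun y hy =>
    (hX.contDiffAt (hΩ₀o.mem_nhds hy)).differentiableAt (by simp)
  have hline : ∀ s t : ℝ, HasDerivAt (fun t : ℝ => (s, t)) ((0 : ℝ), (1 : ℝ)) t := fun s t =>
    (hasDerivAt_const t s).prodMk (hasDerivAt_id t)
  have hlines : ∀ s t : ℝ, HasDerivAt (fun s : ℝ => (s, t)) ((1 : ℝ), (0 : ℝ)) s := fun s t =>
    (hasDerivAt_id s).prodMk (hasDerivAt_const s t)
  have hXt : ∀ y ∈ Ω₀, HasDerivAt (fun t => e (f (q y.1) t)) (fderiv ℝ X y (0, 1)) y.2 :=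
    fun y hy => by
    have h := HasFDerivAt.comp_hasDerivAt (f := fun t => (y.1, t)) y.2 (hXd y hy).hasFDerivAt
      (hline y.1 y.2)
    exact h
  have hΦd : ∀ y ∈ Ω₀, MDifferentiableAt 𝓘(ℝ, ℝ × ℝ) (𝓡 (m + 1)) Φ y := fun y hy =>
    (hΦ.contMDiffAt ((isOpen_univ.prod hJo).mem_nhds hy.1)).mdifferentiableAt (by simp)
  have hvel : ∀ y ∈ Ω₀, fderiv ℝ X y (0, 1)
      = coordOfVec e (Φ y) (velocity (f (q y.1)) y.2).2 := fun y hy => by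
    have h1 : MDifferentiableAt 𝓘(ℝ, ℝ) (𝓡 (m + 1)) (f (q y.1)) y.2 :=
      (hΦd y hy).comp y.2 (f := fun t : ℝ => (y.1, t))
        (hline y.1 y.2).differentiableAt.mdifferentiableAt
    exact (hXt y hy).unique (hasDerivAt_chart_comp he h1 hy.2)
  -- the lift to phase space
  set Z : ℝ × ℝ → Coord (m + 1) × Coord (m + 1) := fun y => (X y, fderiv ℝ X y (0, 1)) with hZdef
  have hZ₀ : ContDiffOn ℝ ∞ Z Ω₀ := hX.prodMk
    ((hX.fderiv_of_isOpen hΩ₀o (by simp)).clm_apply contDiffOn_const)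
  -- The velocity must stay nonzero, since the force is smooth only there.
  set Ω : Set (ℝ × ℝ) := Ω₀ ∩ Z ⁻¹' phaseDomain e with hΩ
  have hΩo : IsOpen Ω := hZ₀.continuousOn.isOpen_inter_preimage hΩ₀o isOpen_phaseDomain
  have hZ : ContDiffOn ℝ ∞ Z Ω := hZ₀.mono inter_subset_left
  have hS : ContDiffOn ℝ ∞ (spray (acceleration e F)) (phaseDomain e) :=
    contDiffOn_snd.prodMk (contDiffOn_acceleration he hF)
  have hSd : ∀ y ∈ Ω, DifferentiableAt ℝ (spray (acceleration e F)) (Z y) := fun y hy =>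
    (hS.contDiffAt (isOpen_phaseDomain.mem_nhds hy.2)).differentiableAt (by simp)
  have hint : ∀ y ∈ Ω, fderiv ℝ Z y (0, 1) = spray (acceleration e F) (Z y) := by
    rintro ⟨s, t⟩ hy
    have hZt : HasDerivAt (fun t => Z (s, t)) (fderiv ℝ Z (s, t) (0, 1)) t :=
      ((hZ.contDiffAt (hΩo.mem_nhds hy)).differentiableAt
        (by simp)).hasFDerivAt.comp_hasDerivAt t (hline s t)
    have h2 : HasDerivAt (fun t => fderiv ℝ X (s, t) (0, 1)) (fderiv ℝ Z (s, t) (0, 1)).2 t := by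
      have h := (hasFDerivAt_snd (𝕜 := ℝ) (p := Z (s, t))).comp_hasDerivAt t hZt
      exact h
    have h1 : HasDerivAt (fun t => X (s, t)) (fderiv ℝ Z (s, t) (0, 1)).1 t := by
      have h := (hasFDerivAt_fst (𝕜 := ℝ) (p := Z (s, t))).comp_hasDerivAt t hZt
      exact h
    refine Prod.ext (h1.unique (hXt _ hy.1)) ?_
    ext k
    have hsec : ∀ᶠ r in nhds t, (s, r) ∈ Ω₀ :=
      (hline s t).continuousAt.eventually_mem (hΩ₀o.mem_nhds hy.1)
    have hcomp : ∀ k r, (s, r) ∈ Ω₀ →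
        HasDerivAt (fun r => e (f (q s) r) k) (fderiv ℝ X (s, r) (0, 1) k) r := fun k r hr =>
      ((EuclideanSpace.proj k : Coord (m + 1) →L[ℝ] ℝ).hasFDerivAt).comp_hasDerivAt r
        (hXt (s, r) hr)
    have hit : iteratedDeriv 2 (fun r => e (f (q s) r) k) t = (fderiv ℝ Z (s, t) (0, 1)).2 k := by
      rw [iteratedDeriv_succ, iteratedDeriv_one]
      have hev : deriv (fun r => e (f (q s) r) k) =ᶠ[nhds t]
          fun r => fderiv ℝ X (s, r) (0, 1) k := by
        filter_upwards [hsec] with r hr using (hcomp k r hr).deriv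
      rw [hev.deriv_eq]
      exact (((EuclideanSpace.proj k : Coord (m + 1) →L[ℝ] ℝ).hasFDerivAt).comp_hasDerivAt t
        h2).deriv
    have hnewton := (hf.trajectory (q s)).newton t hy.1.1.2 e he hy.1.2 k
    rw [hit, (hXt (s, t) hy.1).deriv] at hnewton
    simp only [fun i => (hcomp i t hy.1).deriv] at hnewton
    exact eq_sub_of_add_eq hnewton
  -- initial values
  have hmem₀ : ∀ s, (s, (0 : ℝ)) ∈ Ω₀ := fun s =>
    ⟨⟨trivial, h0J⟩, by
      change f (q s) 0 ∈ e.source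
      rw [(velocity_blowUp_zero (e := e) hf (q s)).1]; exact hp⟩
  -- All curves start at `p₀`, so the initial variation has no position component and its velocity
  -- component is that of the rotating vector.
  have hZ0 : ∀ s, Z (s, 0) = (e p₀, Real.cos s • (ν₀ • coordOfVec e p₀ v)
      + Real.sin s • (ν₀ • coordOfVec e p₀ u)) := fun s => by
    refine Prod.ext (congrArg e (velocity_blowUp_zero (e := e) hf (q s)).1) ?_
    change fderiv ℝ X (s, 0) (0, 1) = _
    rw [hvel _ (hmem₀ s)]
    refine (velocity_blowUp_zero hf (q s)).2.trans ?_
    have hlin : coordOfVec e p₀ (Real.cos s • v + Real.sin s • u)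
        = Real.cos s • coordOfVec e p₀ v + Real.sin s • coordOfVec e p₀ u := by
      have := map_add (mfderiv (𝓡 (m + 1)) (𝓡 (m + 1)) e p₀) (Real.cos s • v) (Real.sin s • u)
      refine this.trans (congrArg₂ _ ?_ ?_)
      · exact map_smul (mfderiv (𝓡 (m + 1)) (𝓡 (m + 1)) e p₀) _ _
      · exact map_smul (mfderiv (𝓡 (m + 1)) (𝓡 (m + 1)) e p₀) _ _
    rw [hqs s, hlin, smul_add, smul_comm ν₀, smul_comm ν₀]
  have hv0 : coordOfVec e p₀ v ≠ 0 := fun h => by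
    have h1 := sum_metricCoeff_coordOfVec he hp v v
    rw [h, real_inner_self_eq_norm_sq, hv] at h1
    simp at h1
  have h00 : ((0 : ℝ), (0 : ℝ)) ∈ Ω := by
    refine ⟨hmem₀ 0, ?_⟩
    change Z (0, 0) ∈ phaseDomain e
    rw [hZ0 0]
    refine ⟨e.map_source hp, ?_⟩
    simpa using ⟨hν.ne', hv0⟩
  obtain ⟨δ, hδ, hball⟩ : ∃ δ > 0, ∀ t ∈ Ioo (-δ) δ, ((0 : ℝ), t) ∈ Ω := by
    have h1 : {t : ℝ | ((0 : ℝ), t) ∈ Ω} ∈ nhds (0 : ℝ) :=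
      (hline 0 0).continuousAt.eventually_mem (hΩo.mem_nhds h00)
    obtain ⟨δ, hδ, h2⟩ := Metric.mem_nhds_iff.1 h1
    refine ⟨δ, hδ, fun t ht => h2 ?_⟩
    rwa [Real.ball_eq_Ioo, zero_sub, zero_add]
  refine ⟨δ, hδ, fun t => Z (0, t), fun t => fderiv ℝ Z (0, t) (1, 0), fun t ht => (hball t ht).2,
    fun t ht => (hasDerivAt_fderiv_integralCurves hΩo hZ hSd hint (hball t ht)).1,
    fun t ht => (hasDerivAt_fderiv_integralCurves hΩo hZ hSd hint (hball t ht)).2, ?_, ?_, ?_⟩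
  · intro t ht
    have hy := hball t ⟨by linarith [ht.1], ht.2⟩
    have hZs : HasDerivAt (fun s => Z (s, t)) (fderiv ℝ Z (0, t) (1, 0)) 0 :=
      ((hZ.contDiffAt (hΩo.mem_nhds hy)).differentiableAt
        (by simp)).hasFDerivAt.comp_hasDerivAt (0 : ℝ) (hlines 0 t)
    have h1 : HasDerivAt (fun s => X (s, t)) (fderiv ℝ Z (0, t) (1, 0)).1 0 := by
      have h := (hasFDerivAt_fst (𝕜 := ℝ) (p := Z (0, t))).comp_hasDerivAt (0 : ℝ) hZs
      exact h
    have hft : MDifferentiableAt (𝓡 m) (𝓡 (m + 1)) (fun q' => f q' t) (q 0) := by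
      have h2 := (hf.smooth.contMDiffAt (x := (q 0, t))
        ((isOpen_univ.prod hJo).mem_nhds ⟨trivial, hy.1.1.2⟩)).mdifferentiableAt (by simp)
      exact h2.comp (q 0) (f := fun q' => (q', t))
        (mdifferentiableAt_id.prodMk mdifferentiableAt_const)
    have hqd : MDifferentiableAt 𝓘(ℝ, ℝ) (𝓡 m) q 0 := hq.mdifferentiableAt (by simp)
    have hγ : MDifferentiableAt 𝓘(ℝ, ℝ) (𝓡 (m + 1)) (fun s => f (q s) t) 0 :=
      hft.comp (0 : ℝ) hqd
    have h3 := h1.unique (hasDerivAt_chart_comp he hγ hy.1.2)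
    -- The variation vector is the image under `f_t` of a tangent vector of the sphere, hence
    -- tangent to the hypersurface, and normality applies to it.
    have h4 : (velocity (fun s => f (q s) t) 0).2 = mfderiv (𝓡 m) (𝓡 (m + 1))
        (fun q' => f q' t) (q 0) (mfderiv 𝓘(ℝ, ℝ) (𝓡 m) q 0 (1 : ℝ)) :=
      mfderiv_comp_apply (0 : ℝ) hft hqd (1 : ℝ)
    rw [fderiv_kinetic_snd he hy.2.1, h3]
    change ∑ i, ∑ j, metricCoeff e i j (e (f (q 0) t)) * fderiv ℝ X (0, t) (0, 1) i * _ = 0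
    rw [hvel _ hy.1, h4]
    exact (sum_metricCoeff_coordOfVec he hy.1.2 _ _).trans (hn t ⟨ht.1, hy.1.1.2.2⟩ (q 0) _)
  · simpa using hZ0 0
  · have hZs : HasDerivAt (fun s => Z (s, 0)) (fderiv ℝ Z (0, 0) (1, 0)) 0 :=
      HasFDerivAt.comp_hasDerivAt (f := fun s : ℝ => (s, (0 : ℝ))) (0 : ℝ)
        ((hZ.contDiffAt (hΩo.mem_nhds h00)).differentiableAt (by simp)).hasFDerivAt (hlines 0 0)
    have h1 : HasDerivAt (fun s : ℝ => (e p₀, Real.cos s • (ν₀ • coordOfVec e p₀ v)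
        + Real.sin s • (ν₀ • coordOfVec e p₀ u)))
        (0, (-Real.sin 0) • (ν₀ • coordOfVec e p₀ v)
          + Real.cos 0 • (ν₀ • coordOfVec e p₀ u)) 0 :=
      (hasDerivAt_const _ _).prodMk (((Real.hasDerivAt_cos 0).smul_const _).add
        ((Real.hasDerivAt_sin 0).smul_const _))
    have h2 := hZs.unique (h1.congr_of_eventuallyEq (Filter.Eventually.of_forall hZ0))
    simpa using h2

end Variation

/-! ### From pointwise conditions to the weak normality equations -/

section WeakNormality

variable {m : ℕ} {M : Type*} [TopologicalSpace M] [ChartedSpace (Coord (m + 1)) M]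
  [IsManifold (𝓡 (m + 1)) ∞ M] [RiemannianBundle (fun p : M => TangentSpace (𝓡 (m + 1)) p)]
  [IsContMDiffRiemannianBundle (𝓡 (m + 1)) ∞ (Coord (m + 1))
    (fun p : M => TangentSpace (𝓡 (m + 1)) p)]
  {F : ∀ p : M, TangentSpace (𝓡 (m + 1)) p → TangentSpace (𝓡 (m + 1)) p}
  {e : OpenPartialHomeomorph M (Coord (m + 1))}

/-- The left-hand side of the third order condition. -/
def thirdOrderForm (e : OpenPartialHomeomorph M (Coord (m + 1)))
    (F : ∀ p : M, TangentSpace (𝓡 (m + 1)) p → TangentSpace (𝓡 (m + 1)) p)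
    (z : Coord (m + 1) × Coord (m + 1)) (u : Coord (m + 1)) : ℝ :=
  fderiv ℝ (fun z => forceForm e F z z.2) z (u, 0)
    + fderiv ℝ (fun z => powerForm (forceForm e F) z u) z (spray (acceleration e F) z)
    + fderiv ℝ (forceForm e F) z (spray (acceleration e F) z) u
    + powerForm (forceForm e F) z (fderiv ℝ (acceleration e F) z (0, u))

theorem powerForm_smul (α : Coord (m + 1) × Coord (m + 1) → Coord (m + 1) →L[ℝ] ℝ)
    (z : Coord (m + 1) × Coord (m + 1)) (c : ℝ) (u : Coord (m + 1)) :
    powerForm α z (c • u) = c * powerForm α z u := by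
  have h : ((0 : Coord (m + 1)), c • u) = c • ((0 : Coord (m + 1)), u) := by simp
  rw [powerForm, h, map_smul, map_smul, powerForm, smul_eq_mul, smul_eq_mul, mul_add]

theorem powerForm_add (α : Coord (m + 1) × Coord (m + 1) → Coord (m + 1) →L[ℝ] ℝ)
    (z : Coord (m + 1) × Coord (m + 1)) (u w : Coord (m + 1)) :
    powerForm α z (u + w) = powerForm α z u + powerForm α z w := by
  have h : ((0 : Coord (m + 1)), u + w) = (0, u) + ((0 : Coord (m + 1)), w) := by simp
  rw [powerForm, h, map_add, map_add, powerForm, powerForm]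
  ring

theorem contDiffOn_powerForm {α : Coord (m + 1) × Coord (m + 1) → Coord (m + 1) →L[ℝ] ℝ}
    {U : Set (Coord (m + 1) × Coord (m + 1))} (hU : IsOpen U) (hα : ContDiffOn ℝ ∞ α U)
    {g : Coord (m + 1) × Coord (m + 1) → Coord (m + 1)} (hg : ContDiffOn ℝ ∞ g U) :
    ContDiffOn ℝ ∞ (fun z => powerForm α z (g z)) U :=
  (((contDiffOn_power hα).fderiv_of_isOpen hU (by simp)).clm_apply
    (contDiffOn_const.prodMk hg)).add (hα.clm_apply hg)

/-- The great-circle variation yields the condition only for vectors of one fixed length;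
homogeneity extends it to all lengths. -/
theorem thirdOrderForm_smul (he : e ∈ IsManifold.maximalAtlas (𝓡 (m + 1)) ∞ M)
    (hF : ∀ k, ContDiffOn ℝ ∞ (fun z : Coord (m + 1) × Coord (m + 1) => forceUp e F k z.1 z.2)
      (phaseDomain e)) {z : Coord (m + 1) × Coord (m + 1)} (hz : z ∈ phaseDomain e) (c : ℝ)
    (u : Coord (m + 1)) : thirdOrderForm e F z (c • u) = c * thirdOrderForm e F z u := by
  have h1 : (c • u, (0 : Coord (m + 1))) = c • (u, (0 : Coord (m + 1))) := by simp
  have h2 : ((0 : Coord (m + 1)), c • u) = c • ((0 : Coord (m + 1)), u) := by simp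
  have hd : DifferentiableAt ℝ (fun z => powerForm (forceForm e F) z u) z :=
    ((contDiffOn_powerForm isOpen_phaseDomain (contDiffOn_forceForm he hF)
      contDiffOn_const).contDiffAt (isOpen_phaseDomain.mem_nhds hz)).differentiableAt (by simp)
  simp only [thirdOrderForm, powerForm_smul, h1, h2, map_smul, smul_eq_mul,
    fderiv_const_mul hd, smul_apply]
  ring

/-- Normal blow-up forces the second and third order conditions on all tangent vectors
orthogonal to the velocity. -/
theorem orders_of_admitsNormalBlowUp (hblow : AdmitsNormalBlowUp F)
    (he : e ∈ IsManifold.maximalAtlas (𝓡 (m + 1)) ∞ M)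
    (hF : ∀ k, ContDiffOn ℝ ∞ (fun z : Coord (m + 1) × Coord (m + 1) => forceUp e F k z.1 z.2)
      (phaseDomain e)) {z : Coord (m + 1) × Coord (m + 1)} (hz : z ∈ phaseDomain e)
    {u : Coord (m + 1)} (hu : fderiv ℝ (kinetic e) z (0, u) = 0) :
    powerForm (forceForm e F) z u = 0 ∧ thirdOrderForm e F z u = 0 := by
  obtain ⟨x, y⟩ := z
  have hx : x ∈ e.target := hz.1
  have hy : y ≠ 0 := hz.2
  -- The zero vector cannot be normalized; homogeneity with factor `0` settles it.
  rcases eq_or_ne u 0 with rfl | hu0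
  · have h1 := powerForm_smul (forceForm e F) (x, y) 0 0
    have h2 := thirdOrderForm_smul he hF hz 0 0
    simp only [zero_mul, smul_zero] at h1 h2
    exact ⟨h1, h2⟩
  set Y : TangentSpace (𝓡 (m + 1)) (e.symm x) := vecOfCoord e x y with hY
  set W : TangentSpace (𝓡 (m + 1)) (e.symm x) := vecOfCoord e x u with hW
  have hY0 : Y ≠ 0 := vecOfCoord_ne_zero he hx hy
  have hW0 : W ≠ 0 := vecOfCoord_ne_zero he hx hu0
  have hYW : inner ℝ Y W = 0 := by
    rw [hY, hW, ← sum_metricCoeff]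
    exact (fderiv_kinetic_snd he (z := (x, y)) hx u).symm.trans hu
  have hν : 0 < ‖Y‖ := norm_pos_iff.2 hY0
  -- With initial speed `‖Y‖` and direction `Y / ‖Y‖`, the phase curve starts exactly at the given
  -- point.
  obtain ⟨ε, hε, f, hf, hn⟩ := hblow (e.symm x) ‖Y‖ hν
  obtain ⟨δ, hδ, z, T, hzU, hz', hT', hφ, hz0, hT0⟩ := exists_variation he hF hν hε hf hn
    (e.map_target hx) (v := ‖Y‖⁻¹ • Y) (u := ‖W‖⁻¹ • W) (norm_smul_inv_norm hY0)
    (norm_smul_inv_norm hW0) (by rw [real_inner_smul_left, real_inner_smul_right, hYW]; simp)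
  have hlin : ∀ (c : ℝ) (w : Coord (m + 1)),
      coordOfVec e (e.symm x) (c • vecOfCoord e x w) = c • w := fun c w => by
    have := map_smul (mfderiv (𝓡 (m + 1)) (𝓡 (m + 1)) e (e.symm x)) c (vecOfCoord e x w)
    refine this.trans ?_
    exact congrArg (c • ·) (coordOfVec_vecOfCoord he hx w)
  rw [hY, hlin, e.right_inv hx, ← hY, smul_smul, mul_inv_cancel₀ hν.ne', one_smul] at hz0
  rw [hW, hlin, ← hW, smul_smul] at hT0
  obtain ⟨h1, h2⟩ := variation_orders isOpen_phaseDomain (contDiffOn_kinetic he)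
    (contDiffOn_forceForm he hF) (contDiffOn_acceleration he hF)
    (fun z hz => energy_equation he hz) (fun z hz u => lagrange_equation he hz u)
    hδ hzU hz' hT' hφ hT0
  rw [hz0] at h1 h2
  have hc : ‖Y‖ * ‖W‖⁻¹ ≠ 0 := mul_ne_zero hν.ne' (inv_ne_zero (norm_ne_zero_iff.2 hW0))
  rw [powerForm_smul] at h1
  change thirdOrderForm e F (x, y) _ = 0 at h2
  rw [thirdOrderForm_smul he hF hz] at h2
  exact ⟨(mul_eq_zero.1 h1).resolve_left hc, (mul_eq_zero.1 h2).resolve_left hc⟩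

/-- Vanishing of `powerForm` on the hyperplane orthogonal to the velocity, at every phase point,
makes it a multiple of `∂K/∂v` throughout the chart. This supplies the open-set proportionality
needed to differentiate along the motion. -/
theorem weakNormalityEquations (hblow : AdmitsNormalBlowUp F)
    (he : e ∈ IsManifold.maximalAtlas (𝓡 (m + 1)) ∞ M)
    (hF : ∀ k, ContDiffOn ℝ ∞ (fun z : Coord (m + 1) × Coord (m + 1) => forceUp e F k z.1 z.2)
      (phaseDomain e)) {x y : Coord (m + 1)} (hx : x ∈ e.target) (hy : y ≠ 0) :
    WeakNormalityEquations e F x y := by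
  have hθ : ∀ z ∈ phaseDomain e, 0 < fderiv ℝ (kinetic e) z (0, z.2) := fun z hz => by
    rw [fderiv_kinetic_snd he hz.1]
    exact sum_metricCoeff_pos he hz.1 hz.2
  -- The multiplier is forced by testing on the velocity; the denominator is the squared speed, so
  -- `l` is differentiable.
  set l : Coord (m + 1) × Coord (m + 1) → ℝ := fun z =>
    powerForm (forceForm e F) z z.2 / fderiv ℝ (kinetic e) z (0, z.2) with hl
  have hprop : ∀ z ∈ phaseDomain e, ∀ u, powerForm (forceForm e F) z u
      = l z * fderiv ℝ (kinetic e) z (0, u) := by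
    intro z hz u
    -- With this `c`, the vector `u - c v` is orthogonal to the velocity.
    set c := fderiv ℝ (kinetic e) z (0, u) / fderiv ℝ (kinetic e) z (0, z.2) with hc
    have hpair : ∀ w : Coord (m + 1),
        ((0 : Coord (m + 1)), u + (-c) • w) = (0, u) + (-c) • ((0 : Coord (m + 1)), w) := by simp
    have h0 : fderiv ℝ (kinetic e) z (0, u + (-c) • z.2) = 0 := by
      rw [hpair, map_add, map_smul, smul_eq_mul, hc]
      have := (hθ z hz).ne'
      field_simp
      ring
    have h1 := (orders_of_admitsNormalBlowUp hblow he hF hz h0).1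
    rw [powerForm_add, powerForm_smul] at h1
    have h2 : l z * fderiv ℝ (kinetic e) z (0, u) = c * powerForm (forceForm e F) z z.2 := by
      rw [hl, hc]; ring
    rw [h2]; linarith
  have hld : DifferentiableOn ℝ l (phaseDomain e) :=
    ((contDiffOn_powerForm isOpen_phaseDomain (contDiffOn_forceForm he hF) contDiffOn_snd).div
      (((contDiffOn_kinetic he).fderiv_of_isOpen isOpen_phaseDomain (m := ∞)
        (by simp)).clm_apply (contDiffOn_const.prodMk contDiffOn_snd))
      (fun z hz => (hθ z hz).ne')).differentiableOn (by simp)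
  have hz : (x, y) ∈ phaseDomain e := ⟨hx, hy⟩
  refine ⟨fun k => ?_, fun k => ?_⟩
  · have hu := fderiv_kinetic_projectorVec he hx hy k
    exact first_equation_of_powerForm he hF hx hy hu
      (orders_of_admitsNormalBlowUp hblow he hF hz hu).1
  · have hu := fderiv_kinetic_projectorVec he hx hy k
    exact second_equation_of_third_order he hF hx hy (hprop _ hz)
      (third_order_of_proportional isOpen_phaseDomain (contDiffOn_kinetic he)
        (contDiffOn_acceleration he hF) (fun z hz => energy_equation he hz)
        (fun z hz u => lagrange_equation he hz u) hld hprop hz hu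
        (orders_of_admitsNormalBlowUp hblow he hF hz hu).2)

end WeakNormality

end NormalBlowUp

end

theorem theorem3p1 {m : ℕ} {M : Type*} [TopologicalSpace M]
    [ChartedSpace (EuclideanSpace ℝ (Fin (m + 1))) M] [IsManifold (𝓡 (m + 1)) ∞ M]
    [RiemannianBundle (fun p : M => TangentSpace (𝓡 (m + 1)) p)]
    [IsContMDiffRiemannianBundle (𝓡 (m + 1)) ∞ (EuclideanSpace ℝ (Fin (m + 1)))
      (fun p : M => TangentSpace (𝓡 (m + 1)) p)]
    (F : ∀ p : M, TangentSpace (𝓡 (m + 1)) p → TangentSpace (𝓡 (m + 1)) p)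
    (hF : ContMDiffOn (𝓡 (m + 1)).tangent (𝓡 (m + 1)).tangent ∞
      (fun q : TangentBundle (𝓡 (m + 1)) M =>
        (⟨q.proj, F q.proj q.snd⟩ : TangentBundle (𝓡 (m + 1)) M))
      {q | q.snd ≠ 0})
    (hblow : NormalBlowUp.AdmitsNormalBlowUp F)
    (p : M) (v : TangentSpace (𝓡 (m + 1)) p) (hv : v ≠ 0)
    (e : OpenPartialHomeomorph M (EuclideanSpace ℝ (Fin (m + 1))))
    (he : e ∈ IsManifold.maximalAtlas (𝓡 (m + 1)) ∞ M) (hp : p ∈ e.source) :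
    NormalBlowUp.WeakNormalityEquations e F (e p) (NormalBlowUp.coordOfVec e p v) := by
  refine NormalBlowUp.weakNormalityEquations hblow he (NormalBlowUp.contDiffOn_forceUp he hF)
    (e.map_source hp) fun h => ?_
  have h1 := NormalBlowUp.sum_metricCoeff_coordOfVec he hp v v
  rw [h] at h1
  exact hv (inner_self_eq_zero (𝕜 := ℝ).1 (by rw [← h1]; simp))
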